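/- Let $\mathbb D$ be the open unit disc and let $\mathcal A$ be the Neil algebra: the continuous functions $a$ on $\overline{\mathbb D}$ that are analytic in $\mathbb D$ and satisfy $a'(0)=0$. For $F\in M_n(\mathcal A)$ put $\|F\|_n=\sup_{z\in\mathbb D}\|F(z)\|$, with the operator norm of matrices on $\mathbb C^n$. A *representation* of $\mathcal A$ on a complex Hilbert space $H$ is a multiplicative linear map $\rho:\mathcal A\to B(H)$. It is *unital* if $\rho(1)=I$; *completely contractive* if $\|(\rho(F_{jk}))_{j,k}\|_{B(H^{\oplus n})}\le\|F\|_n$ for all $n$ and all $F=(F_{jk})\in M_n(\mathcal A)$; *pure* if $\bigcap_a\rho(a)H=\{0\}$, where $a$ runs over the elements of $\mathcal A$ that have no zero on the unit circle. A representation $\pi$ on $H$ is *extremal* if, whenever $\rho$ is a completely contractive representation of $\mathcal A$ on a Hilbert space $K$ and $V:H\to K$ is an isometry with $\pi(a)=V^*\rho(a)V$ for all $a\in\mathcal A$, one has $V\pi(a)=\rho(a)V$ for all $a\in\mathcal A$. Representations $\rho$ on $H$ and $\sigma$ on $H'$ are *unitarily equivalent* if there is a unitary $U:H\to H'$ with $U\rho(a)=\sigma(a)U$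 for all $a\in\mathcal A$. For a complex Hilbert space $\mathcal N$ let $H^2_{\mathcal N}$ be the Hardy space of $\mathcal N$-valued analytic functions $f$ on $\mathbb D$ with $\|f\|^2=\sup_{0<r<1}\frac1{2\pi}\int_0^{2\pi}\|f(re^{it})\|^2\,dt<\infty$, and let $\mathcal N\oplus z\mathcal N\subset H^2_{\mathcal N}$ be the subspace of the functions $z\mapsto c+zd$ with $c,d\in\mathcal N$. For a subspace $\mathcal V$ of $\mathcal N\oplus z\mathcal N$ let $\pi_{\mathcal V}$ be the representation of $\mathcal A$ on $H^2_{\mathcal N}\ominus\mathcal V$ given by $\pi_{\mathcal V}(a)f=af$. **Theorem.** For every Hilbert space $\mathcal N$ and every subspace $\mathcal V\subseteq\mathcal N\oplus z\mathcal N$, the representation $\pi_{\mathcal V}$ is unital, pure, completely contractive and extremal. Conversely, if $\nu$ is a unital, pure, extremal, completely contractive representation of $\mathcal A$ on a Hilbert space, then there are a Hilbert space $\mathcal N$ and a closed subspace $\mathcal V\subseteq\mathcal N\oplus z\mathcal N$ such that $\nu$ is unitarily equivalent to $\pi_{\mathcal V}$. -/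

import Mathlib

open scoped InnerProductSpace

noncomputable section

namespace NeilRep

/-! ### Taylor coefficients and integral means -/

section Taylor

variable {N : Type*} [NormedAddCommGroup N] [InnerProductSpace ℂ N] [CompleteSpace N]

/-- The `n`-th Taylor coefficient at `0`. -/
def taylorCoeff (f : ℂ → N) (n : ℕ) : N := (n.factorial : ℂ)⁻¹ • iteratedDeriv n f 0

/-- The integral mean `(2π)⁻¹ ∫₀^{2π} ‖f(r e^{it})‖² dt`. -/
def meanSq (f : ℂ → N) (r : ℝ) : ℝ := Real.circleAverage (fun z => ‖f z‖ ^ 2) 0 r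

theorem hasSum_taylorCoeff {f : ℂ → N} (hf : DifferentiableOn ℂ f (Metric.ball 0 1)) {z : ℂ}
    (hz : z ∈ Metric.ball (0 : ℂ) 1) : HasSum (fun n => z ^ n • taylorCoeff f n) (f z) := by
  have h := Complex.hasSum_taylorSeries_on_ball hf hz
  convert h using 2 with n
  rw [taylorCoeff, sub_zero, smul_comm]

theorem summable_taylorCoeff {f : ℂ → N} (hf : DifferentiableOn ℂ f (Metric.ball 0 1)) {r : ℝ}
    (hr0 : 0 ≤ r) (hr : r < 1) : Summable (fun n => r ^ n * ‖taylorCoeff f n‖) := by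
  obtain ⟨s, hrs, hs⟩ := exists_between hr
  have hs0 : 0 < s := hr0.trans_lt hrs
  have h := hasSum_taylorCoeff hf (z := (s : ℂ)) (by simpa [abs_of_pos hs0] using hs)
  have ht := h.summable.tendsto_atTop_zero.norm
  obtain ⟨C, hC⟩ := ht.bddAbove_range
  have hC' : ∀ n, s ^ n * ‖taylorCoeff f n‖ ≤ C := fun n => by
    have := hC ⟨n, rfl⟩
    simpa [norm_smul, abs_of_pos hs0] using this
  refine Summable.of_nonneg_of_le (fun n => by positivity) (fun n => ?_)
    ((summable_geometric_of_lt_one (r := r / s) (by positivity)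
      ((div_lt_one hs0).2 hrs)).mul_left C)
  calc r ^ n * ‖taylorCoeff f n‖ = (s ^ n * ‖taylorCoeff f n‖) * (r / s) ^ n := by
        rw [div_pow]; field_simp
    _ ≤ C * (r / s) ^ n := by gcongr; exact hC' n

theorem circleAverage_taylorCoeff {f : ℂ → N} (hf : DifferentiableOn ℂ f (Metric.ball 0 1)) {r : ℝ}
    (hr0 : 0 < r) (hr : r < 1) (n : ℕ) :
    Real.circleAverage (fun z => (z ^ n)⁻¹ • f z) 0 r = taylorCoeff f n := by
  have h := DifferentiableOn.circleIntegral_one_div_sub_center_pow_smul hr0 n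
    (hf.mono (Metric.closedBall_subset_ball hr))
  rw [Real.circleAverage_eq_circleIntegral hr0.ne']
  have e : (fun z : ℂ => (z - 0)⁻¹ • (z ^ n)⁻¹ • f z) = fun z => (1 / (z - 0) ^ (n + 1)) • f z := by
    funext z
    rw [smul_smul, pow_succ, one_div, mul_inv_rev]; simp
  rw [e, h, smul_smul, taylorCoeff]
  congr 1
  have : (2 * Real.pi * Complex.I : ℂ) ≠ 0 := Complex.two_pi_I_ne_zero
  field_simp

theorem continuous_circle {f : ℂ → N} (hf : DifferentiableOn ℂ f (Metric.ball 0 1)) {r : ℝ}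
    (hr0 : 0 ≤ r) (hr : r < 1) : Continuous (fun t => f (circleMap 0 r t)) := by
  refine hf.continuousOn.comp_continuous (continuous_circleMap 0 r) (fun t => ?_)
  simpa [abs_of_nonneg hr0] using hr

/-- Parseval's identity on the circle of radius `r`. -/
theorem hasSum_meanSq {f : ℂ → N} (hf : DifferentiableOn ℂ f (Metric.ball 0 1)) {r : ℝ}
    (hr0 : 0 < r) (hr : r < 1) :
    HasSum (fun n => r ^ (2 * n) * ‖taylorCoeff f n‖ ^ 2) (meanSq f r) := by
  have hg := continuous_circle hf hr0.le hr
  have hzb : ∀ t, circleMap 0 r t ∈ Metric.ball (0 : ℂ) 1 := fun t => by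
    simpa [abs_of_pos hr0] using hr
  obtain ⟨M, hM⟩ : ∃ M, ∀ t, ‖f (circleMap 0 r t)‖ ≤ M := by
    obtain ⟨M, hM⟩ := (isCompact_sphere (0 : ℂ) r).exists_bound_of_continuousOn
      (hf.continuousOn.mono (Metric.sphere_subset_ball hr))
    exact ⟨M, fun t => hM _ (circleMap_mem_sphere 0 hr0.le t)⟩
  -- the expansion of the square norm, termwise
  let F : ℕ → ℝ → ℂ := fun n t =>
    ⟪(circleMap 0 r t) ^ n • taylorCoeff f n, f (circleMap 0 r t)⟫_ℂ
  have hs : HasSum (fun n => ∫ t in (0 : ℝ)..2 * Real.pi, F n t)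
      (∫ t in (0 : ℝ)..2 * Real.pi, ((‖f (circleMap 0 r t)‖ ^ 2 : ℝ) : ℂ)) := by
    refine intervalIntegral.hasSum_integral_of_dominated_convergence
      (fun n _ => r ^ n * ‖taylorCoeff f n‖ * M) (fun n => ?_) (fun n => ?_) ?_ ?_ ?_
    · refine Continuous.aestronglyMeasurable ?_
      exact Continuous.inner (((continuous_circleMap 0 r).pow n).smul continuous_const) hg
    · refine Filter.Eventually.of_forall fun t _ => ?_
      refine (norm_inner_le_norm _ _).trans ?_
      have : ‖(circleMap 0 r t) ^ n • taylorCoeff f n‖ = r ^ n * ‖taylorCoeff f n‖ := by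
        simp [norm_smul, abs_of_pos hr0]
      rw [this]
      gcongr
      exact hM t
    · exact Filter.Eventually.of_forall fun t _ =>
        (summable_taylorCoeff hf hr0.le hr).mul_right M
    · exact intervalIntegrable_const
    · refine Filter.Eventually.of_forall fun t _ => ?_
      have h1 := (hasSum_taylorCoeff hf (hzb t))
      have h2 := h1.mapL ((innerSLFlip ℂ) (f (circleMap 0 r t)))
      simpa [F, inner_self_eq_norm_sq_to_K, inner_smul_left, mul_comm] using h2
  have hterm : ∀ n, ∫ t in (0 : ℝ)..2 * Real.pi, F n t =
      ((2 * Real.pi * (r ^ (2 * n) * ‖taylorCoeff f n‖ ^ 2) : ℝ) : ℂ) := by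
    intro n
    have hne : ∀ t, circleMap 0 r t ≠ 0 := fun t => circleMap_ne_center hr0.ne'
    have hF : ∀ t, F n t = (r : ℂ) ^ (2 * n) *
        (innerSL ℂ (taylorCoeff f n)) ((circleMap 0 r t ^ n)⁻¹ • f (circleMap 0 r t)) := by
      intro t
      have hc : (starRingEnd ℂ) (circleMap 0 r t) * circleMap 0 r t = (r : ℂ) ^ 2 := by
        rw [mul_comm, Complex.mul_conj, Complex.normSq_eq_norm_sq]
        simp
      have hc' : (starRingEnd ℂ) (circleMap 0 r t) ^ n
          = (r : ℂ) ^ (2 * n) * (circleMap 0 r t ^ n)⁻¹ := by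
        rw [pow_mul, ← hc, mul_pow]
        field_simp [hne t]
      simp only [F, inner_smul_left, map_pow, innerSL_apply_apply, inner_smul_right, hc']
      ring
    simp_rw [hF]
    rw [intervalIntegral.integral_const_mul]
    have hi : IntervalIntegrable (fun t => (circleMap 0 r t ^ n)⁻¹ • f (circleMap 0 r t))
        MeasureTheory.volume 0 (2 * Real.pi) := by
      refine Continuous.intervalIntegrable ?_ _ _
      exact (((continuous_circleMap 0 r).pow n).inv₀ (fun t => pow_ne_zero _ (hne t))).smul hg
    rw [ContinuousLinearMap.intervalIntegral_comp_comm _ hi]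
    have hav := circleAverage_taylorCoeff hf hr0 hr n
    rw [Real.circleAverage, inv_smul_eq_iff₀ (by positivity)] at hav
    rw [hav, innerSL_apply_apply, ← Complex.coe_smul, inner_smul_right,
      inner_self_eq_norm_sq_to_K, show ∀ x : ℝ, (RCLike.ofReal x : ℂ) = (x : ℂ) from fun _ => rfl]
    push_cast
    ring
  simp_rw [hterm] at hs
  rw [intervalIntegral.integral_ofReal, Complex.hasSum_ofReal] at hs
  have := hs.mul_left (2 * Real.pi)⁻¹
  rw [meanSq, Real.circleAverage, smul_eq_mul]
  simpa only [inv_mul_cancel_left₀ Real.two_pi_pos.ne'] using this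

theorem taylorCoeff_zero (f : ℂ → N) : taylorCoeff f 0 = f 0 := by simp [taylorCoeff]

/-- Integral means are at most the sum of the squares of the coefficients. -/
theorem meanSq_le_tsum {f : ℂ → N} (hf : DifferentiableOn ℂ f (Metric.ball 0 1))
    (hs : Summable fun n => ‖taylorCoeff f n‖ ^ 2) {r : ℝ} (hr0 : 0 < r) (hr : r < 1) :
    meanSq f r ≤ ∑' n, ‖taylorCoeff f n‖ ^ 2 := by
  refine hasSum_le (fun n => ?_) (hasSum_meanSq hf hr0 hr) hs.hasSum
  exact mul_le_of_le_one_left (by positivity) (pow_le_one₀ hr0.le hr.le)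

/-- A bound on the integral means bounds the partial sums of squares of the coefficients. -/
theorem sum_sq_le {f : ℂ → N} (hf : DifferentiableOn ℂ f (Metric.ball 0 1)) {C : ℝ}
    (hC : ∀ r, 0 < r → r < 1 → meanSq f r ≤ C) (s : Finset ℕ) :
    ∑ n ∈ s, ‖taylorCoeff f n‖ ^ 2 ≤ C := by
  have hcont : Filter.Tendsto (fun r : ℝ => ∑ n ∈ s, r ^ (2 * n) * ‖taylorCoeff f n‖ ^ 2)
      (nhdsWithin 1 (Set.Iio 1)) (nhds (∑ n ∈ s, (1 : ℝ) ^ (2 * n) * ‖taylorCoeff f n‖ ^ 2)) := by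
    refine tendsto_nhdsWithin_of_tendsto_nhds (Continuous.tendsto ?_ 1)
    fun_prop
  simp only [one_pow, one_mul] at hcont
  refine le_of_tendsto hcont ?_
  filter_upwards [Ioo_mem_nhdsLT (show (0 : ℝ) < 1 by norm_num)] with r hr
  refine (sum_le_hasSum s (fun n _ => ?_) (hasSum_meanSq hf hr.1 hr.2)).trans (hC r hr.1 hr.2)
  have := hr.1
  positivity

theorem summable_sq {f : ℂ → N} (hf : DifferentiableOn ℂ f (Metric.ball 0 1)) {C : ℝ}
    (hC : ∀ r, 0 < r → r < 1 → meanSq f r ≤ C) : Summable fun n => ‖taylorCoeff f n‖ ^ 2 :=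
  summable_of_sum_le (fun _ => by positivity) (sum_sq_le hf hC)

/-- Power series with bounded coefficients: differentiability and coefficients. -/
theorem powerSeries_aux (a : ℕ → N) {C : ℝ} (hC : ∀ n, ‖a n‖ ≤ C) :
    ∃ f : ℂ → N, DifferentiableOn ℂ f (Metric.ball 0 1) ∧ (∀ z ∉ Metric.ball (0 : ℂ) 1, f z = 0) ∧
      ∀ n, taylorCoeff f n = a n := by
  let p : FormalMultilinearSeries ℂ ℂ N := fun n =>
    ContinuousMultilinearMap.mkPiRing ℂ (Fin n) (a n)
  have hrad : (1 : ENNReal) ≤ p.radius := by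
    have := p.le_radius_of_bound C (r := 1) (fun n => by simpa [p] using hC n)
    simpa using this
  have hp := (p.hasFPowerSeriesOnBall (lt_of_lt_of_le zero_lt_one hrad)).mono zero_lt_one hrad
  have hball : Metric.eball (0 : ℂ) 1 = Metric.ball 0 1 := by
    rw [← ENNReal.ofReal_one, Metric.eball_ofReal]
  have hd : DifferentiableOn ℂ p.sum (Metric.ball 0 1) := by
    have := hp.differentiableOn
    rwa [hball] at this
  classical
  refine ⟨fun z => if z ∈ Metric.ball (0 : ℂ) 1 then p.sum z else 0, ?_, ?_, ?_⟩
  · exact hd.congr fun z hz => by simp only [if_pos hz]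
  · exact fun z hz => by simp only [if_neg hz]
  · intro n
    have hev : (fun z => if z ∈ Metric.ball (0 : ℂ) 1 then p.sum z else 0) =ᶠ[nhds 0] p.sum := by
      filter_upwards [Metric.ball_mem_nhds (0 : ℂ) one_pos] with z hz
      simp only [if_pos hz]
    have h := hp.factorial_smul (1 : ℂ) n
    rw [taylorCoeff, hev.iteratedDeriv_eq, iteratedDeriv_eq_iteratedFDeriv]
    rw [← h]
    simp only [p, ContinuousMultilinearMap.mkPiRing_apply, Finset.prod_const_one, one_smul]
    rw [← Nat.cast_smul_eq_nsmul ℂ, smul_smul, inv_mul_cancel₀ (by exact_mod_cast n.factorial_ne_zero),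
      one_smul]

end Taylor

/-! ### The Hardy space -/

section Hardy

variable (N : Type*) [NormedAddCommGroup N] [InnerProductSpace ℂ N] [CompleteSpace N]

/-- The `N`-valued functions that are analytic on the open unit disc and whose integral means
`(2π)⁻¹ ∫ ‖f(r e^{it})‖² dt`, `0 < r < 1`, are bounded. Functions on the disc are represented by
functions on `ℂ` that vanish outside the disc. -/
def hardySubmodule : Submodule ℂ (ℂ → N) where
  carrier := {f | DifferentiableOn ℂ f (Metric.ball 0 1) ∧
    (∀ z ∉ Metric.ball (0 : ℂ) 1, f z = 0) ∧ ∃ C, ∀ r, 0 < r → r < 1 → meanSq f r ≤ C}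
  add_mem' := by
    rintro f g ⟨hf, hf0, C, hC⟩ ⟨hg, hg0, D, hD⟩
    refine ⟨hf.add hg, fun z hz => by simp [hf0 z hz, hg0 z hz], 2 * C + 2 * D, fun r hr0 hr => ?_⟩
    have cf := (continuous_circle hf hr0.le hr).norm.pow 2
    have cg := (continuous_circle hg hr0.le hr).norm.pow 2
    have cfg := (continuous_circle (hf.add hg) hr0.le hr).norm.pow 2
    have hf' : CircleIntegrable (fun z => ‖f z‖ ^ 2) 0 r := cf.intervalIntegrable _ _
    have hg' : CircleIntegrable (fun z => ‖g z‖ ^ 2) 0 r := cg.intervalIntegrable _ _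
    have hfg' : CircleIntegrable (fun z => ‖(f + g) z‖ ^ 2) 0 r := cfg.intervalIntegrable _ _
    have h1 : meanSq (f + g) r ≤
        Real.circleAverage (fun z => 2 * ‖f z‖ ^ 2 + 2 * ‖g z‖ ^ 2) 0 r := by
      refine Real.circleAverage_mono hfg' ?_ (fun z _ => ?_)
      · exact ((cf.const_mul 2).add (cg.const_mul 2)).intervalIntegrable _ _
      · have := norm_add_le (f z) (g z)
        have h0 := norm_nonneg (f z + g z)
        simp only [Pi.add_apply]
        nlinarith [sq_nonneg (‖f z‖ - ‖g z‖)]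
    have h2 : Real.circleAverage (fun z => 2 * ‖f z‖ ^ 2 + 2 * ‖g z‖ ^ 2) 0 r =
        2 * meanSq f r + 2 * meanSq g r := by
      have e1 := Real.circleAverage_fun_smul (a := (2 : ℝ)) (f := fun z => ‖f z‖ ^ 2) (c := 0) (R := r)
      have e2 := Real.circleAverage_fun_smul (a := (2 : ℝ)) (f := fun z => ‖g z‖ ^ 2) (c := 0) (R := r)
      simp only [smul_eq_mul] at e1 e2
      rw [Real.circleAverage_fun_add, e1, e2]
      · rfl
      · exact (cf.const_mul 2).intervalIntegrable _ _
      · exact (cg.const_mul 2).intervalIntegrable _ _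
    linarith [hC r hr0 hr, hD r hr0 hr]
  zero_mem' := ⟨differentiableOn_const 0, fun _ _ => rfl, 0, fun r _ _ => by
    simp [meanSq, Real.circleAverage]⟩
  smul_mem' := by
    rintro c f ⟨hf, hf0, C, hC⟩
    refine ⟨hf.const_smul c, fun z hz => by simp [hf0 z hz], ‖c‖ ^ 2 * C, fun r hr0 hr => ?_⟩
    have e : meanSq (c • f) r = ‖c‖ ^ 2 * meanSq f r := by
      rw [meanSq, meanSq, ← smul_eq_mul, ← Real.circleAverage_fun_smul]
      simp only [Pi.smul_apply, norm_smul, mul_pow, smul_eq_mul]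
    rw [e]
    gcongr
    exact hC r hr0 hr

/-- The Hardy space `H²_N` of `N`-valued analytic functions on the unit disc. -/
def Hardy : Type _ := hardySubmodule N

variable {N}

namespace Hardy

instance : AddCommGroup (Hardy N) := inferInstanceAs (AddCommGroup (hardySubmodule N))
instance : Module ℂ (Hardy N) := inferInstanceAs (Module ℂ (hardySubmodule N))
instance : FunLike (Hardy N) ℂ N := ⟨fun f => f.1, Subtype.val_injective⟩

theorem differentiableOn (f : Hardy N) : DifferentiableOn ℂ f (Metric.ball 0 1) := f.2.1

theorem apply_eq_zero (f : Hardy N) {z : ℂ} (hz : z ∉ Metric.ball (0 : ℂ) 1) : f z = 0 := f.2.2.1 z hz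

@[ext] theorem ext {f g : Hardy N} (h : ∀ z ∈ Metric.ball (0 : ℂ) 1, f z = g z) : f = g := by
  refine Subtype.ext (funext fun z => ?_)
  by_cases hz : z ∈ Metric.ball (0 : ℂ) 1
  · exact h z hz
  · exact (f.apply_eq_zero hz).trans (g.apply_eq_zero hz).symm

@[simp] theorem add_apply (f g : Hardy N) (z : ℂ) : (f + g) z = f z + g z := rfl
@[simp] theorem smul_apply (c : ℂ) (f : Hardy N) (z : ℂ) : (c • f) z = c • f z := rfl
@[simp] theorem zero_apply (z : ℂ) : (0 : Hardy N) z = 0 := rfl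

theorem summable_coeff (f : Hardy N) : Summable fun n => ‖taylorCoeff f n‖ ^ 2 :=
  f.2.2.2.elim fun _ hC => summable_sq f.differentiableOn hC

theorem memlp_coeff (f : Hardy N) : Memℓp (taylorCoeff f) 2 :=
  memℓp_gen (by simpa using f.summable_coeff)

theorem taylorCoeff_add (f g : Hardy N) (n : ℕ) :
    taylorCoeff (f + g : Hardy N) n = taylorCoeff f n + taylorCoeff g n := by
  have hf := (f.differentiableOn.analyticAt (Metric.ball_mem_nhds 0 one_pos)).contDiffAt (n := n)
  have hg := (g.differentiableOn.analyticAt (Metric.ball_mem_nhds 0 one_pos)).contDiffAt (n := n)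
  rw [taylorCoeff, taylorCoeff, taylorCoeff, ← smul_add]
  exact congrArg _ (iteratedDeriv_add hf hg)

theorem taylorCoeff_smul (c : ℂ) (f : Hardy N) (n : ℕ) :
    taylorCoeff (c • f : Hardy N) n = c • taylorCoeff f n := by
  rw [taylorCoeff, taylorCoeff, smul_comm c]
  exact congrArg _ (iteratedDeriv_const_smul_field (n := n) (x := 0) c (f : ℂ → N))

/-- The sequence of Taylor coefficients. -/
def coeffLin : Hardy N →ₗ[ℂ] lp (fun _ : ℕ => N) 2 where
  toFun f := ⟨taylorCoeff f, f.memlp_coeff⟩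
  map_add' f g := by
    ext n
    exact taylorCoeff_add f g n
  map_smul' c f := by
    ext n
    exact taylorCoeff_smul c f n

/-- The Taylor coefficients identify `H²_N` with the square summable sequences in `N`. -/
def coeffEquiv : Hardy N ≃ₗ[ℂ] lp (fun _ : ℕ => N) 2 :=
  LinearEquiv.ofBijective coeffLin
    (by
      constructor
      · intro f g h
        have h' : ∀ n, taylorCoeff f n = taylorCoeff g n := fun n =>
          congrFun (congrArg Subtype.val h) n
        refine Hardy.ext fun z hz => ?_
        refine (hasSum_taylorCoeff f.differentiableOn hz).unique ?_
        simp_rw [h']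
        exact hasSum_taylorCoeff g.differentiableOn hz
      · intro a
        obtain ⟨f, hd, h0, hc⟩ := powerSeries_aux a (fun n => lp.norm_apply_le_norm (by simp) a n)
        have hs : Summable fun n => ‖taylorCoeff f n‖ ^ 2 := by
          have := (lp.memℓp a).summable (by simp)
          simpa [hc] using this
        refine ⟨⟨f, hd, h0, _, fun r hr0 hr => meanSq_le_tsum hd hs hr0 hr⟩, ?_⟩
        ext n
        exact hc n)

@[simp] theorem coeffEquiv_apply (f : Hardy N) (n : ℕ) : coeffEquiv f n = taylorCoeff f n := rfl

/-- The norm is `‖f‖² = ∑ ‖f̂(n)‖²`, where `f̂(n)` are the Taylor coefficients. -/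
instance : NormedAddCommGroup (Hardy N) :=
  NormedAddCommGroup.induced (Hardy N) (lp (fun _ : ℕ => N) 2) coeffEquiv coeffEquiv.injective

/-- The inner product is `⟪f, g⟫ = ∑ ⟪f̂(n), ĝ(n)⟫`. -/
instance : InnerProductSpace ℂ (Hardy N) where
  __ := NormedSpace.induced ℂ (Hardy N) (lp (fun _ : ℕ => N) 2) coeffEquiv
  inner f g := ⟪coeffEquiv f, coeffEquiv g⟫_ℂ
  norm_sq_eq_re_inner f := norm_sq_eq_re_inner (coeffEquiv f)
  conj_inner_symm f g := inner_conj_symm (coeffEquiv f) (coeffEquiv g)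
  add_left f g h := by rw [map_add, inner_add_left]
  smul_left f g c := by rw [map_smul, inner_smul_left]

/-- The Taylor coefficients as a unitary map. -/
def coeffIsometry : Hardy N ≃ₗᵢ[ℂ] lp (fun _ : ℕ => N) 2 where
  toLinearEquiv := coeffEquiv
  norm_map' _ := rfl

instance : CompleteSpace (Hardy N) :=
  (completeSpace_congr (e := (coeffIsometry (N := N)).toEquiv)
    (coeffIsometry (N := N)).isometry.isUniformEmbedding).2 inferInstance

theorem inner_eq_tsum (f g : Hardy N) :
    ⟪f, g⟫_ℂ = ∑' n, ⟪taylorCoeff f n, taylorCoeff g n⟫_ℂ :=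
  lp.inner_eq_tsum (coeffEquiv f) (coeffEquiv g)

theorem norm_sq_eq_tsum (f : Hardy N) : ‖f‖ ^ 2 = ∑' n, ‖taylorCoeff f n‖ ^ 2 := by
  have h : ‖f‖ = ‖coeffEquiv f‖ := rfl
  have := lp.norm_rpow_eq_tsum (p := 2) (by simp) (coeffEquiv f)
  rw [h]
  simpa using this

/-- The norm is the usual Hardy space norm, `‖f‖² = sup_{r < 1} (2π)⁻¹ ∫ ‖f(r e^{it})‖² dt`. -/
theorem isLUB_norm_sq (f : Hardy N) : IsLUB (meanSq f '' Set.Ioo 0 1) (‖f‖ ^ 2) := by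
  rw [norm_sq_eq_tsum]
  constructor
  · rintro _ ⟨r, hr, rfl⟩
    exact meanSq_le_tsum f.differentiableOn f.summable_coeff hr.1 hr.2
  · intro C hC
    exact Summable.tsum_le_of_sum_le f.summable_coeff
      (sum_sq_le f.differentiableOn fun r hr0 hr => hC ⟨r, ⟨hr0, hr⟩, rfl⟩)

end Hardy

end Hardy

/-! ### The Neil algebra -/

section Algebra

/-- A function on the closed unit disc as a function on `ℂ`, extended by `0`. -/
def discExt (a : C(Metric.closedBall (0 : ℂ) 1, ℂ)) (z : ℂ) : ℂ :=
  open Classical in if h : z ∈ Metric.closedBall (0 : ℂ) 1 then a ⟨z, h⟩ else 0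

theorem discExt_of_mem (a : C(Metric.closedBall (0 : ℂ) 1, ℂ)) {z : ℂ}
    (h : z ∈ Metric.closedBall (0 : ℂ) 1) : discExt a z = a ⟨z, h⟩ := dif_pos h

theorem discExt_add (a b : C(Metric.closedBall (0 : ℂ) 1, ℂ)) :
    discExt (a + b) = discExt a + discExt b := by
  funext z; by_cases h : z ∈ Metric.closedBall (0 : ℂ) 1 <;> simp [discExt, h]

theorem discExt_mul (a b : C(Metric.closedBall (0 : ℂ) 1, ℂ)) :
    discExt (a * b) = discExt a * discExt b := by
  funext z; by_cases h : z ∈ Metric.closedBall (0 : ℂ) 1 <;> simp [discExt, h]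

theorem discExt_smul (c : ℂ) (a : C(Metric.closedBall (0 : ℂ) 1, ℂ)) :
    discExt (c • a) = c • discExt a := by
  funext z; by_cases h : z ∈ Metric.closedBall (0 : ℂ) 1 <;> simp [discExt, h]

theorem norm_discExt_le (a : C(Metric.closedBall (0 : ℂ) 1, ℂ)) (z : ℂ) : ‖discExt a z‖ ≤ ‖a‖ := by
  by_cases h : z ∈ Metric.closedBall (0 : ℂ) 1
  · rw [discExt_of_mem a h]; exact a.norm_coe_le_norm _
  · simp [discExt, h]

/-- The disc algebra: continuous functions on the closed unit disc, analytic in the open disc. -/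
def discAlgebra : Subalgebra ℂ C(Metric.closedBall (0 : ℂ) 1, ℂ) where
  carrier := {a | DifferentiableOn ℂ (discExt a) (Metric.ball 0 1)}
  add_mem' {a b} ha hb := by
    simp only [Set.mem_ofPred_eq, discExt_add] at *
    exact ha.add hb
  mul_mem' {a b} ha hb := by
    simp only [Set.mem_ofPred_eq, discExt_mul] at *
    exact ha.mul hb
  algebraMap_mem' c := by
    refine (differentiableOn_const c).congr fun z hz => ?_
    rw [discExt_of_mem _ (Metric.ball_subset_closedBall hz)]
    rfl

theorem discAlgebra_differentiableAt {a : C(Metric.closedBall (0 : ℂ) 1, ℂ)}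
    (ha : a ∈ discAlgebra) : DifferentiableAt ℂ (discExt a) 0 :=
  DifferentiableOn.differentiableAt ha (Metric.ball_mem_nhds 0 one_pos)

/-- The Neil algebra: the elements `a` of the disc algebra with `a'(0) = 0`. -/
def neilAlgebra : Subalgebra ℂ C(Metric.closedBall (0 : ℂ) 1, ℂ) where
  carrier := {a | a ∈ discAlgebra ∧ deriv (discExt a) 0 = 0}
  add_mem' := by
    rintro a b ⟨ha, ha'⟩ ⟨hb, hb'⟩
    refine ⟨add_mem ha hb, ?_⟩
    rw [discExt_add, deriv_add (discAlgebra_differentiableAt ha) (discAlgebra_differentiableAt hb),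
      ha', hb', add_zero]
  mul_mem' := by
    rintro a b ⟨ha, ha'⟩ ⟨hb, hb'⟩
    refine ⟨mul_mem ha hb, ?_⟩
    rw [discExt_mul, deriv_mul (discAlgebra_differentiableAt ha) (discAlgebra_differentiableAt hb),
      ha', hb', zero_mul, mul_zero, add_zero]
  algebraMap_mem' c := by
    refine ⟨algebraMap_mem _ c, ?_⟩
    have : discExt (algebraMap ℂ _ c) =ᶠ[nhds 0] fun _ => c := by
      filter_upwards [Metric.closedBall_mem_nhds (0 : ℂ) one_pos] with z hz
      rw [discExt_of_mem _ hz]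
      rfl
    rw [this.deriv_eq, deriv_const]

/-- The norm of a square matrix over the Neil algebra: the supremum over the open disc of the
operator norm (on Euclidean space) of the matrix of values. -/
def matrixNorm {n : ℕ} (F : Matrix (Fin n) (Fin n) neilAlgebra) : ℝ :=
  ⨆ z : Metric.ball (0 : ℂ) 1,
    ‖Matrix.toEuclideanCLM (𝕜 := ℂ) (F.map fun a => discExt (a : C(_, ℂ)) z)‖

end Algebra

/-! ### Representations of the Neil algebra -/

section Rep

variable {H : Type*} [NormedAddCommGroup H] [InnerProductSpace ℂ H]

/-- The operator `1_n ⊗ ρ (F)` on `H ⊕ ⋯ ⊕ H` (with `n` summands): the operator matrix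
`(ρ (F i j))`. -/
def amplify (ρ : neilAlgebra →ₙₐ[ℂ] (H →L[ℂ] H)) {n : ℕ} (F : Matrix (Fin n) (Fin n) neilAlgebra) :
    PiLp 2 (fun _ : Fin n => H) →L[ℂ] PiLp 2 (fun _ : Fin n => H) :=
  (PiLp.continuousLinearEquiv 2 ℂ (fun _ : Fin n => H)).symm.toContinuousLinearMap ∘L
    ContinuousLinearMap.pi fun i => ∑ j, ρ (F i j) ∘L PiLp.proj 2 (fun _ : Fin n => H) j

theorem amplify_apply (ρ : neilAlgebra →ₙₐ[ℂ] (H →L[ℂ] H)) {n : ℕ}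
    (F : Matrix (Fin n) (Fin n) neilAlgebra) (h : PiLp 2 (fun _ : Fin n => H)) (i : Fin n) :
    amplify ρ F h i = ∑ j, ρ (F i j) (h j) := by
  simp [amplify]

/-- A unital representation. -/
def IsUnital (ρ : neilAlgebra →ₙₐ[ℂ] (H →L[ℂ] H)) : Prop := ρ 1 = 1

/-- `‖1_n ⊗ ρ (F)‖ ≤ ‖F‖_n` for all `n` and all `n × n` matrices `F` over the algebra. -/
def IsCompletelyContractive (ρ : neilAlgebra →ₙₐ[ℂ] (H →L[ℂ] H)) : Prop :=
  ∀ (n : ℕ) (F : Matrix (Fin n) (Fin n) neilAlgebra), ‖amplify ρ F‖ ≤ matrixNorm F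

/-- Purity: the ranges of the operators `ρ a` have intersection `{0}`, where `a` runs through the
elements of the algebra without zeros on the unit circle. (Some restriction on `a` is needed, as
`a = 0` would make the intersection trivial. If a function vanishing at a point `λ` of the circle
were admitted, the character `a ↦ a(λ)`, which extends to a point evaluation on the continuous
functions on the circle, would count as pure.) -/
def IsPure (ρ : neilAlgebra →ₙₐ[ℂ] (H →L[ℂ] H)) : Prop :=
  ⋂ a ∈ {a : neilAlgebra | ∀ z : ℂ, ‖z‖ = 1 → discExt (a : C(_, ℂ)) z ≠ 0}, Set.range (ρ a) = {0}

/-- Extremality: every dilation `ρ` of `π` to a completely contractive representation extends `π`.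
The dilations are tested on the Hilbert spaces `K` of a universe `v`. -/
def IsExtremal.{v, u} {H : Type u} [NormedAddCommGroup H] [InnerProductSpace ℂ H] [CompleteSpace H]
    (π : neilAlgebra →ₙₐ[ℂ] (H →L[ℂ] H)) : Prop :=
  ∀ (K : Type v) [NormedAddCommGroup K] [InnerProductSpace ℂ K] [CompleteSpace K]
    (ρ : neilAlgebra →ₙₐ[ℂ] (K →L[ℂ] K)), IsCompletelyContractive ρ →
    ∀ V : H →ₗᵢ[ℂ] K,
      (∀ a, π a = V.toContinuousLinearMap.adjoint ∘L ρ a ∘L V.toContinuousLinearMap) →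
      ∀ a, V.toContinuousLinearMap ∘L π a = ρ a ∘L V.toContinuousLinearMap

/-- Unitary equivalence of representations. -/
def UnitarilyEquivalent {H' : Type*} [NormedAddCommGroup H'] [InnerProductSpace ℂ H']
    (ρ : neilAlgebra →ₙₐ[ℂ] (H →L[ℂ] H)) (σ : neilAlgebra →ₙₐ[ℂ] (H' →L[ℂ] H')) : Prop :=
  ∃ U : H ≃ₗᵢ[ℂ] H', ∀ a h, U (ρ a h) = σ a (U h)

end Rep

/-! ### The multiplication representations -/

section Multiplication

variable {N : Type*} [NormedAddCommGroup N] [InnerProductSpace ℂ N] [CompleteSpace N]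

theorem meanSq_mul_le {a : C(Metric.closedBall (0 : ℂ) 1, ℂ)} (ha : a ∈ discAlgebra) (f : Hardy N)
    {r : ℝ} (hr0 : 0 < r) (hr : r < 1) :
    meanSq (fun z => discExt a z • f z) r ≤ ‖a‖ ^ 2 * meanSq f r := by
  have hd : DifferentiableOn ℂ (fun z => discExt a z • f z) (Metric.ball 0 1) :=
    DifferentiableOn.smul ha f.differentiableOn
  have c1 := (continuous_circle hd hr0.le hr).norm.pow 2
  have c2 := (continuous_circle f.differentiableOn hr0.le hr).norm.pow 2
  rw [meanSq, meanSq, ← smul_eq_mul, ← Real.circleAverage_fun_smul]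
  refine Real.circleAverage_mono (c1.intervalIntegrable _ _)
    (Continuous.intervalIntegrable (c2.const_smul (‖a‖ ^ 2)) 0 (2 * Real.pi)) (fun z _ => ?_)
  simp only [norm_smul, mul_pow, smul_eq_mul]
  gcongr
  exact norm_discExt_le a z

/-- The product `a f` of an element `a` of the disc algebra and `f ∈ H²_N`. -/
def mulHardy {a : C(Metric.closedBall (0 : ℂ) 1, ℂ)} (ha : a ∈ discAlgebra) (f : Hardy N) :
    Hardy N :=
  ⟨fun z => discExt a z • f z, DifferentiableOn.smul ha f.differentiableOn,
    fun z hz => by simp only [f.apply_eq_zero hz, smul_zero], ‖a‖ ^ 2 * ‖f‖ ^ 2, fun r hr0 hr =>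
      (meanSq_mul_le ha f hr0 hr).trans (mul_le_mul_of_nonneg_left
        (f.isLUB_norm_sq.1 ⟨r, ⟨hr0, hr⟩, rfl⟩) (by positivity))⟩

theorem mulHardy_apply {a : C(Metric.closedBall (0 : ℂ) 1, ℂ)} (ha : a ∈ discAlgebra)
    (f : Hardy N) (z : ℂ) : mulHardy ha f z = discExt a z • f z := rfl

theorem norm_mulHardy_le {a : C(Metric.closedBall (0 : ℂ) 1, ℂ)} (ha : a ∈ discAlgebra)
    (f : Hardy N) : ‖mulHardy ha f‖ ≤ ‖a‖ * ‖f‖ := by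
  refine le_of_sq_le_sq ?_ (by positivity)
  rw [mul_pow]
  refine (mulHardy ha f).isLUB_norm_sq.2 ?_
  rintro _ ⟨r, hr, rfl⟩
  exact (meanSq_mul_le ha f hr.1 hr.2).trans (mul_le_mul_of_nonneg_left
        (f.isLUB_norm_sq.1 ⟨r, hr, rfl⟩) (by positivity))

/-- Multiplication by `a` as a bounded operator on `H²_N`. -/
def mulOp {a : C(Metric.closedBall (0 : ℂ) 1, ℂ)} (ha : a ∈ discAlgebra) : Hardy N →L[ℂ] Hardy N :=
  LinearMap.mkContinuous
    { toFun := mulHardy ha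
      map_add' := fun f g => Hardy.ext fun z _ => by simp [mulHardy_apply]
      map_smul' := fun c f => Hardy.ext fun z _ => by
        simp [mulHardy_apply, smul_comm c] } ‖a‖ (norm_mulHardy_le ha)

theorem mulOp_apply {a : C(Metric.closedBall (0 : ℂ) 1, ℂ)} (ha : a ∈ discAlgebra)
    (f : Hardy N) (z : ℂ) : mulOp ha f z = discExt a z • f z := rfl

variable (N) in
/-- The subspace `N ⊕ zN` of `H²_N`. -/
def linearPart : Submodule ℂ (Hardy N) where
  carrier := {f | ∃ c d : N, ∀ z ∈ Metric.ball (0 : ℂ) 1, f z = c + z • d}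
  add_mem' := by
    rintro f g ⟨c, d, h⟩ ⟨c', d', h'⟩
    refine ⟨c + c', d + d', fun z hz => ?_⟩
    rw [Hardy.add_apply, h z hz, h' z hz, smul_add]
    abel
  zero_mem' := ⟨0, 0, fun z _ => by simp⟩
  smul_mem' := by
    rintro k f ⟨c, d, h⟩
    refine ⟨k • c, k • d, fun z hz => ?_⟩
    rw [Hardy.smul_apply, h z hz, smul_add, smul_comm k]

theorem taylorCoeff_one (f : ℂ → N) : taylorCoeff f 1 = deriv f 0 := by
  simp [taylorCoeff, iteratedDeriv_one]

theorem taylorCoeff_of_mem_linearPart {f : Hardy N} (hf : f ∈ linearPart N) (n : ℕ) :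
    taylorCoeff f (n + 2) = 0 := by
  obtain ⟨c, d, h⟩ := hf
  have hev : (f : ℂ → N) =ᶠ[nhds 0] fun z => c + z • d := by
    filter_upwards [Metric.ball_mem_nhds (0 : ℂ) one_pos] with z hz using h z hz
  have h1 : deriv (fun z : ℂ => c + z • d) = fun _ => d := by
    funext z
    simpa using (((hasDerivAt_id z).smul_const d).const_add c).deriv
  rw [taylorCoeff, hev.iteratedDeriv_eq, iteratedDeriv_succ', h1, iteratedDeriv_succ', deriv_const']
  simp

/-- If `a` is in the Neil algebra and `v ∈ N ⊕ zN` then `⟪v, a f⟫ = a(0) ⟪v, f⟫`. -/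
theorem inner_mulOp {a : C(Metric.closedBall (0 : ℂ) 1, ℂ)} (ha : a ∈ neilAlgebra)
    {v : Hardy N} (hv : v ∈ linearPart N) (f : Hardy N) :
    ⟪v, mulOp ha.1 f⟫_ℂ = discExt a 0 * ⟪v, f⟫_ℂ := by
  have hz : ∀ g : Hardy N, ⟪v, g⟫_ℂ =
      ⟪taylorCoeff v 0, taylorCoeff g 0⟫_ℂ + ⟪taylorCoeff v 1, taylorCoeff g 1⟫_ℂ := by
    intro g
    rw [Hardy.inner_eq_tsum, tsum_eq_sum (s := Finset.range 2)]
    · simp [Finset.sum_range_succ]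
    · intro n hn
      obtain ⟨m, rfl⟩ : ∃ m, n = m + 2 := ⟨n - 2, by simp at hn; omega⟩
      rw [taylorCoeff_of_mem_linearPart hv, inner_zero_left]
  have h0 : taylorCoeff (mulOp ha.1 f) 0 = discExt a 0 • taylorCoeff f 0 := by
    rw [taylorCoeff_zero, taylorCoeff_zero, mulOp_apply]
  have h1 : taylorCoeff (mulOp ha.1 f) 1 = discExt a 0 • taylorCoeff f 1 := by
    rw [taylorCoeff_one, taylorCoeff_one]
    have hfd : DifferentiableAt ℂ f 0 :=
      f.differentiableOn.differentiableAt (Metric.ball_mem_nhds 0 one_pos)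
    have := deriv_smul (discAlgebra_differentiableAt ha.1) hfd
    rw [ha.2, zero_smul, add_zero] at this
    exact this
  rw [hz, hz f, h0, h1, inner_smul_right, inner_smul_right]
  ring

theorem mulOp_mem_orthogonal {a : C(Metric.closedBall (0 : ℂ) 1, ℂ)} (ha : a ∈ neilAlgebra)
    {V : Submodule ℂ (Hardy N)} (hV : V ≤ linearPart N) (f : Hardy N) (hf : f ∈ Vᗮ) :
    mulOp ha.1 f ∈ Vᗮ := by
  rw [Submodule.mem_orthogonal] at *
  intro v hv
  rw [inner_mulOp ha (hV hv), hf v hv, mul_zero]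

/-- The representation `π_V` of the Neil algebra on `H²_N ⊖ V`, for a subspace `V` of `N ⊕ zN`:
`π_V(a)` is multiplication by `a`. -/
def mulRep (V : Submodule ℂ (Hardy N)) (hV : V ≤ linearPart N) :
    neilAlgebra →ₙₐ[ℂ] (Vᗮ →L[ℂ] Vᗮ) where
  toFun a := (mulOp a.2.1).restrict (mulOp_mem_orthogonal a.2 hV)
  map_smul' c a := by
    ext f : 2
    refine Hardy.ext fun z _ => ?_
    change discExt (c • (a : C(_, ℂ))) z • (f : Hardy N) z
      = c • (discExt (a : C(_, ℂ)) z • (f : Hardy N) z)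
    rw [discExt_smul, Pi.smul_apply, smul_assoc]
  map_zero' := by
    ext f : 2
    refine Hardy.ext fun z _ => ?_
    change discExt 0 z • (f : Hardy N) z = 0
    simp [discExt]
  map_add' a b := by
    ext f : 2
    refine Hardy.ext fun z _ => ?_
    change discExt (a.1 + b.1) z • (f : Hardy N) z
      = discExt (a : C(_, ℂ)) z • (f : Hardy N) z + discExt (b : C(_, ℂ)) z • (f : Hardy N) z
    rw [discExt_add, Pi.add_apply, add_smul]
  map_mul' a b := by
    ext f : 2
    refine Hardy.ext fun z _ => ?_
    change discExt (a.1 * b.1) z • (f : Hardy N) z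
      = discExt (a : C(_, ℂ)) z • discExt (b : C(_, ℂ)) z • (f : Hardy N) z
    rw [discExt_mul, Pi.mul_apply, mul_smul]

/-- `π_V(a) f` is the pointwise product `a f`. -/
theorem mulRep_apply (V : Submodule ℂ (Hardy N)) (hV : V ≤ linearPart N) (a : neilAlgebra) (f : Vᗮ)
    (z : ℂ) : (mulRep V hV a f : Hardy N) z = discExt (a : C(_, ℂ)) z • (f : Hardy N) z := rfl

end Multiplication

end NeilRep

end

universe u v w

/-!
Multiplication by `zⁿ`, `n ≠ 1`, is isometric on `H²_N ⊖ V`, and these monomials span a dense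
subspace of the Neil algebra `𝒜`. A contraction that compresses to an isometry on a subspace
maps that subspace into itself, so every dilation of `π_V` contains `π_V` as a restriction.

Conversely, complete contractivity makes the pairing of `(h, a, h')` with `⟪h, ν(a) h'⟫`
positive. A Riesz extension and the Gelfand–Naimark–Segal construction dilate `ν` to a
`*`-representation `M` of `C(𝕋)`, and extremality makes `ν` the restriction of `M` to a
subspace `X`. Put `U = M(z)`. The space `L = {x | U²x ∈ X, U³x ∈ X}` contains `X` and is
invariant under `U`. The part of `L` that reduces `U` lies in `X` and is therefore killed by
purity, so the Wold decomposition identifies `U` on `L` with the shift on some `H²_N`. Since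
`U²L ⊆ X`, the complement `V` of `X` in `H²_N` is orthogonal to `z²H²_N`, which means
`V ⊆ N ⊕ zN`.
-/

noncomputable section

namespace NeilRep

/-! ### Values of matrices over the Neil algebra -/

section MatrixValues

/-- The point evaluation `a ↦ a(z)` at a point `z` of the closed disc. -/
def evalAt (z : Metric.closedBall (0 : ℂ) 1) : neilAlgebra →ₐ[ℂ] ℂ :=
  (ContinuousMap.evalAlgHom ℂ ℂ z).comp neilAlgebra.val

theorem evalAt_apply (z : Metric.closedBall (0 : ℂ) 1) (a : neilAlgebra) :
    evalAt z a = (a : C(_, ℂ)) z := rfl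

variable {n : ℕ}

/-- The value at `z` of a matrix over the Neil algebra, as an operator on `ℂⁿ`. -/
def evalMatrix (z : Metric.closedBall (0 : ℂ) 1) :
    Matrix (Fin n) (Fin n) neilAlgebra →ₐ[ℂ]
      (EuclideanSpace ℂ (Fin n) →L[ℂ] EuclideanSpace ℂ (Fin n)) :=
  (Matrix.toEuclideanCLM (n := Fin n) (𝕜 := ℂ)).toAlgEquiv.toAlgHom.comp (evalAt z).mapMatrix

theorem evalMatrix_apply (z : Metric.closedBall (0 : ℂ) 1)
    (F : Matrix (Fin n) (Fin n) neilAlgebra) (v : EuclideanSpace ℂ (Fin n)) (i : Fin n) :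
    evalMatrix z F v i = ∑ j, evalAt z (F i j) * v j := by
  change (Matrix.toEuclideanCLM (𝕜 := ℂ) (F.map (evalAt z)) v) i = _
  rw [Matrix.ofLp_toEuclideanCLM]
  rfl

theorem toEuclideanCLM_discExt (F : Matrix (Fin n) (Fin n) neilAlgebra) {z : ℂ}
    (hz : z ∈ Metric.closedBall (0 : ℂ) 1) :
    Matrix.toEuclideanCLM (𝕜 := ℂ) (F.map fun a => discExt (a : C(_, ℂ)) z) =
      evalMatrix ⟨z, hz⟩ F := by
  simp_rw [discExt_of_mem _ hz]
  rfl

theorem continuous_evalMatrix (F : Matrix (Fin n) (Fin n) neilAlgebra) :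
    Continuous fun z => evalMatrix z F :=
  (LinearMap.continuous_of_finiteDimensional
      (Matrix.toEuclideanCLM (n := Fin n) (𝕜 := ℂ)).toAlgEquiv.toLinearMap).comp
    (continuous_matrix fun i j => (F i j : C(Metric.closedBall (0 : ℂ) 1, ℂ)).continuous)

theorem diffContOnCl_toEuclideanCLM_discExt (F : Matrix (Fin n) (Fin n) neilAlgebra) :
    DiffContOnCl ℂ
      (fun z => Matrix.toEuclideanCLM (𝕜 := ℂ) (F.map fun a => discExt (a : C(_, ℂ)) z))
      (Metric.ball 0 1) := by
  constructor
  · let L : (Fin n → Fin n → ℂ) →L[ℂ] EuclideanSpace ℂ (Fin n) →L[ℂ] EuclideanSpace ℂ (Fin n) :=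
      ((Matrix.toEuclideanCLM (n := Fin n) (𝕜 := ℂ)).toAlgEquiv.toLinearMap ∘ₗ
        (Matrix.ofLinearEquiv ℂ).toLinearMap).toContinuousLinearMap
    exact L.differentiable.comp_differentiableOn (differentiableOn_pi.2 fun i =>
      differentiableOn_pi.2 fun j => (F i j).2.1)
  · rw [closure_ball 0 one_ne_zero, continuousOn_iff_continuous_domRestrict]
    exact (continuous_evalMatrix F).congr fun z => (toEuclideanCLM_discExt F z.2).symm

theorem norm_evalMatrix_le (z : Metric.closedBall (0 : ℂ) 1)
    (F : Matrix (Fin n) (Fin n) neilAlgebra) : ‖evalMatrix z F‖ ≤ matrixNorm F := by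
  have hbdd : BddAbove (Set.range fun z : Metric.ball (0 : ℂ) 1 =>
      ‖Matrix.toEuclideanCLM (𝕜 := ℂ) (F.map fun a => discExt (a : C(_, ℂ)) z)‖) := by
    refine (isCompact_range (continuous_evalMatrix F).norm).bddAbove.mono ?_
    rintro _ ⟨w, rfl⟩
    exact ⟨_, congrArg norm (toEuclideanCLM_discExt F (Metric.ball_subset_closedBall w.2)).symm⟩
  rw [← toEuclideanCLM_discExt F z.2]
  refine le_on_closure (fun w hw => le_ciSup hbdd ⟨w, hw⟩)
    (diffContOnCl_toEuclideanCLM_discExt F).continuousOn.norm continuousOn_const ?_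
  rw [closure_ball 0 one_ne_zero]
  exact z.2

theorem matrixNorm_nonneg (F : Matrix (Fin n) (Fin n) neilAlgebra) : 0 ≤ matrixNorm F :=
  Real.iSup_nonneg fun _ => norm_nonneg _

theorem matrixNorm_le_of_forall_norm_evalMatrix_le {F : Matrix (Fin n) (Fin n) neilAlgebra} {C : ℝ}
    (hC : ∀ z, ‖evalMatrix z F‖ ≤ C) : matrixNorm F ≤ C := by
  have : Nonempty (Metric.ball (0 : ℂ) 1) := ⟨⟨0, Metric.mem_ball_self one_pos⟩⟩
  refine ciSup_le fun z => ?_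
  rw [toEuclideanCLM_discExt F (Metric.ball_subset_closedBall z.2)]
  exact hC _

/-- The inclusion of the unit circle into the closed disc. -/
def circleInclusion : C(Circle, Metric.closedBall (0 : ℂ) 1) :=
  ⟨fun z => ⟨z, by simp [z.norm_coe]⟩, by fun_prop⟩

theorem matrixNorm_le_of_forall_circle {F : Matrix (Fin n) (Fin n) neilAlgebra} {C : ℝ}
    (hC : ∀ z, ‖evalMatrix (circleInclusion z) F‖ ≤ C) : matrixNorm F ≤ C := by
  refine matrixNorm_le_of_forall_norm_evalMatrix_le fun z => ?_
  rw [← toEuclideanCLM_discExt F z.2]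
  refine Complex.norm_le_of_forall_mem_frontier_norm_le Metric.isBounded_ball
    (diffContOnCl_toEuclideanCLM_discExt F) (fun w hw => ?_) ?_
  · rw [frontier_ball 0 one_ne_zero] at hw
    rw [toEuclideanCLM_discExt F (Metric.sphere_subset_closedBall hw)]
    exact hC ⟨w, hw⟩
  · rw [closure_ball 0 one_ne_zero]
    exact z.2

theorem sum_norm_sq_sum_evalAt_mul_le (z : Metric.closedBall (0 : ℂ) 1)
    (F : Matrix (Fin n) (Fin n) neilAlgebra) (v : Fin n → ℂ) :
    ∑ i, ‖∑ j, evalAt z (F i j) * v j‖ ^ 2 ≤ matrixNorm F ^ 2 * ∑ j, ‖v j‖ ^ 2 := by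
  have h := pow_le_pow_left₀ (norm_nonneg _)
    ((evalMatrix z F).le_of_opNorm_le (norm_evalMatrix_le z F) (WithLp.toLp 2 v)) 2
  simpa only [mul_pow, EuclideanSpace.norm_sq_eq, evalMatrix_apply] using h

theorem matrixNorm_of_fin_one_le (a : neilAlgebra) :
    matrixNorm (Matrix.of fun _ _ : Fin 1 => a) ≤ ‖a‖ := by
  refine matrixNorm_le_of_forall_norm_evalMatrix_le fun z =>
    ContinuousLinearMap.opNorm_le_bound _ (norm_nonneg a) fun v => ?_
  rw [EuclideanSpace.norm_eq, EuclideanSpace.norm_eq, Fin.sum_univ_one, Fin.sum_univ_one,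
    Real.sqrt_sq (norm_nonneg _), Real.sqrt_sq (norm_nonneg _), evalMatrix_apply, Fin.sum_univ_one,
    norm_mul]
  exact mul_le_mul_of_nonneg_right (ContinuousMap.norm_coe_le_norm a.1 z) (norm_nonneg (v 0))

end MatrixValues

/-! ### Completely contractive representations -/

section CompletelyContractive

variable {H : Type*} [NormedAddCommGroup H] [InnerProductSpace ℂ H]
  {ρ : neilAlgebra →ₙₐ[ℂ] (H →L[ℂ] H)}

theorem isCompletelyContractive_iff_sum_norm_sq_le :
    IsCompletelyContractive ρ ↔ ∀ (n : ℕ) (F : Matrix (Fin n) (Fin n) neilAlgebra) (x : Fin n → H),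
      ∑ i, ‖∑ j, ρ (F i j) (x j)‖ ^ 2 ≤ matrixNorm F ^ 2 * ∑ j, ‖x j‖ ^ 2 := by
  refine forall₂_congr fun n F => ?_
  have hsq (x : PiLp 2 fun _ : Fin n => H) : ‖amplify ρ F x‖ ≤ matrixNorm F * ‖x‖ ↔
      ∑ i, ‖∑ j, ρ (F i j) (x j)‖ ^ 2 ≤ matrixNorm F ^ 2 * ∑ j, ‖x j‖ ^ 2 := by
    rw [← sq_le_sq₀ (norm_nonneg _) (mul_nonneg (matrixNorm_nonneg F) (norm_nonneg _)), mul_pow,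
      PiLp.norm_sq_eq_of_L2, PiLp.norm_sq_eq_of_L2]
    simp only [amplify_apply]
  rw [ContinuousLinearMap.opNorm_le_iff (matrixNorm_nonneg F)]
  exact ⟨fun h x => (hsq (WithLp.toLp 2 x)).1 (h _), fun h x => (hsq x).2 (h x)⟩

namespace IsCompletelyContractive

theorem norm_apply_le (hρ : IsCompletelyContractive ρ) (a : neilAlgebra) : ‖ρ a‖ ≤ ‖a‖ := by
  refine ContinuousLinearMap.opNorm_le_bound _ (norm_nonneg a) fun h => ?_
  have hsq := isCompletelyContractive_iff_sum_norm_sq_le.1 hρ 1 (Matrix.of fun _ _ => a) fun _ => h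
  simp only [Fin.sum_univ_one, Matrix.of_apply, ← mul_pow] at hsq
  exact (le_of_sq_le_sq hsq (mul_nonneg (matrixNorm_nonneg _) (norm_nonneg h))).trans
    (mul_le_mul_of_nonneg_right (matrixNorm_of_fin_one_le a) (norm_nonneg h))

theorem continuous_apply (hρ : IsCompletelyContractive ρ) (h : H) : Continuous fun a => ρ a h := by
  have hcont : Continuous ρ :=
    AddMonoidHomClass.continuous_of_bound ρ 1 fun a => by
      rw [one_mul]; exact hρ.norm_apply_le a
  exact hcont.clm_apply continuous_const

end IsCompletelyContractive

end CompletelyContractive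

/-! ### Density of the polynomials without linear term -/

section Density

/-- The function `zⁿ` on the closed disc. -/
def monomial (n : ℕ) : C(Metric.closedBall (0 : ℂ) 1, ℂ) := ⟨fun z => (z : ℂ) ^ n, by fun_prop⟩

theorem discExt_monomial (n : ℕ) {z : ℂ} (hz : z ∈ Metric.closedBall (0 : ℂ) 1) :
    discExt (monomial n) z = z ^ n := discExt_of_mem _ hz

theorem norm_monomial_le (n : ℕ) : ‖monomial n‖ ≤ 1 := by
  refine (ContinuousMap.norm_le _ zero_le_one).2 fun z => ?_
  rw [monomial, ContinuousMap.coe_mk, norm_pow]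
  exact pow_le_one₀ (norm_nonneg _) (mem_closedBall_zero_iff.1 z.2)

theorem monomial_mem_discAlgebra (n : ℕ) : monomial n ∈ discAlgebra :=
  (differentiable_pow n).differentiableOn.congr fun _ hz =>
    discExt_monomial n (Metric.ball_subset_closedBall hz)

theorem monomial_mem_neilAlgebra {n : ℕ} (hn : n ≠ 1) : monomial n ∈ neilAlgebra := by
  refine ⟨monomial_mem_discAlgebra n, ?_⟩
  have hpow : discExt (monomial n) =ᶠ[nhds 0] fun z => z ^ n := by
    filter_upwards [Metric.closedBall_mem_nhds (0 : ℂ) one_pos] with z hz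
    exact discExt_monomial n hz
  rw [hpow.deriv_eq, deriv_pow_field]
  obtain rfl | hn0 := eq_or_ne n 0
  · simp
  · rw [zero_pow (Nat.sub_ne_zero_of_lt (by omega)), mul_zero]

/-- The function `zⁿ`, `n ≠ 1`, as an element of the Neil algebra. -/
def neilMonomial {n : ℕ} (hn : n ≠ 1) : neilAlgebra := ⟨monomial n, monomial_mem_neilAlgebra hn⟩

/-- The maps `z ↦ r z` of the closed disc into itself, as a continuous family in `r ∈ [0, 1]`. -/
def dilation : C(unitInterval, C(Metric.closedBall (0 : ℂ) 1, Metric.closedBall (0 : ℂ) 1)) :=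
  ContinuousMap.curry
    { toFun := fun p => ⟨(p.1 : ℝ) * p.2, by
        rw [mem_closedBall_zero_iff, norm_mul, Complex.norm_real, Real.norm_of_nonneg p.1.2.1]
        exact mul_le_one₀ p.1.2.2 (norm_nonneg _) (mem_closedBall_zero_iff.1 p.2.2)⟩
      continuous_toFun := by fun_prop }

theorem dilation_one : dilation 1 = ContinuousMap.id _ := by
  ext z
  exact (congrArg (· * (z : ℂ)) Complex.ofReal_one).trans (one_mul _)

theorem hasSum_comp_dilation {a : C(Metric.closedBall (0 : ℂ) 1, ℂ)} (ha : a ∈ discAlgebra)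
    {r : unitInterval} (hr : r < 1) :
    HasSum (fun n => ((r : ℂ) ^ n * taylorCoeff (discExt a) n) • monomial n)
      (a.comp (dilation r)) := by
  have hsum : Summable fun n => ((r : ℂ) ^ n * taylorCoeff (discExt a) n) • monomial n := by
    refine Summable.of_norm_bounded (summable_taylorCoeff ha r.2.1 hr) fun n => ?_
    rw [norm_smul, norm_mul, norm_pow, Complex.norm_real, Real.norm_of_nonneg r.2.1]
    exact mul_le_of_le_one_right (mul_nonneg (pow_nonneg r.2.1 n) (norm_nonneg _))
      (norm_monomial_le n)
  convert hsum.hasSum using 1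
  ext z
  have hz : (r * z : ℂ) ∈ Metric.ball (0 : ℂ) 1 := by
    rw [mem_ball_zero_iff, norm_mul, Complex.norm_real, Real.norm_of_nonneg r.2.1]
    exact (mul_le_of_le_one_right r.2.1 (mem_closedBall_zero_iff.1 z.2)).trans_lt hr
  rw [← ContinuousMap.tsum_apply hsum, ContinuousMap.comp_apply,
    ← discExt_of_mem a (dilation r z).2]
  refine (hasSum_taylorCoeff ha hz).tsum_eq.symm.trans (tsum_congr fun n => ?_)
  rw [mul_pow, smul_eq_mul, mul_right_comm]
  rfl

theorem mem_closure_span_monomial {a : C(Metric.closedBall (0 : ℂ) 1, ℂ)} (ha : a ∈ neilAlgebra) :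
    a ∈ (Submodule.span ℂ (monomial '' {1}ᶜ)).topologicalClosure := by
  set P := (Submodule.span ℂ (monomial '' {1}ᶜ)).topologicalClosure
  have hcont : Continuous fun r => a.comp (dilation r) := by fun_prop
  have hlt : Set.Iio 1 ⊆ (fun r => a.comp (dilation r)) ⁻¹' P := by
    intro r hr
    refine (Submodule.isClosed_topologicalClosure _).mem_of_tendsto (hasSum_comp_dilation ha.1 hr)
      (.of_forall fun s => P.sum_mem fun n _ => ?_)
    obtain rfl | hn := eq_or_ne n 1
    · rw [taylorCoeff_one, ha.2, mul_zero, zero_smul]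
      exact P.zero_mem
    · exact P.smul_mem _ (Submodule.le_topologicalClosure _
        (Submodule.subset_span (Set.mem_image_of_mem _ hn)))
  have hle := closure_minimal hlt ((Submodule.isClosed_topologicalClosure _).preimage hcont)
  rw [closure_Iio' ⟨0, zero_lt_one⟩] at hle
  have h1 : a.comp (dilation 1) ∈ P := hle Set.self_mem_Iic
  rwa [dilation_one, ContinuousMap.comp_id] at h1

theorem dense_span_neilMonomial :
    Dense (Submodule.span ℂ {a : neilAlgebra | ∃ (n : ℕ) (hn : n ≠ 1), a = neilMonomial hn} :
      Set neilAlgebra) := by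
  refine Subtype.dense_iff.2 fun a ha => closure_mono ?_ (mem_closure_span_monomial ha)
  change _ ≤ (Submodule.span ℂ _).map neilAlgebra.val.toLinearMap
  rw [Submodule.span_le]
  rintro _ ⟨n, hn, rfl⟩
  exact ⟨neilMonomial hn, Submodule.subset_span ⟨n, hn, rfl⟩, rfl⟩

theorem eq_of_eq_neilMonomial {E : Type*} [AddCommGroup E] [Module ℂ E] [TopologicalSpace E]
    [T2Space E] {S T : neilAlgebra →ₗ[ℂ] E} (hS : Continuous S) (hT : Continuous T)
    (h : ∀ (n : ℕ) (hn : n ≠ 1), S (neilMonomial hn) = T (neilMonomial hn)) : S = T := by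
  refine LinearMap.ext fun a => congrFun (hS.ext_on dense_span_neilMonomial hT ?_) a
  refine LinearMap.eqOn_span ?_
  rintro _ ⟨n, hn, rfl⟩
  exact h n hn

end Density

/-! ### Extremality -/

section Extremality

variable {H K : Type*} [NormedAddCommGroup H] [InnerProductSpace ℂ H] [CompleteSpace H]
  [NormedAddCommGroup K] [InnerProductSpace ℂ K] [CompleteSpace K]

theorem map_adjoint_eq_of_norm_le (V : H →ₗᵢ[ℂ] K) {y : K}
    (hy : ‖y‖ ≤ ‖V.toContinuousLinearMap.adjoint y‖) :
    V (V.toContinuousLinearMap.adjoint y) = y := by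
  refine (eq_of_norm_le_re_inner_eq_norm_sq (𝕜 := ℂ) (by rwa [V.norm_map]) ?_).symm
  rw [V.norm_map, inner_re_symm, ← inner_self_eq_norm_sq (𝕜 := ℂ)]
  exact congrArg _ (V.toContinuousLinearMap.adjoint_inner_right _ y).symm

theorem isExtremal_of_norm_apply_neilMonomial {π : neilAlgebra →ₙₐ[ℂ] (H →L[ℂ] H)}
    (hπ : ∀ (n : ℕ) (hn : n ≠ 1) (h : H), ‖π (neilMonomial hn) h‖ = ‖h‖) : IsExtremal π := by
  intro K _ _ _ ρ hρ V hV
  have hVadj (a : neilAlgebra) (h : H) : π a h = V.toContinuousLinearMap.adjoint (ρ a (V h)) := by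
    rw [hV a]; rfl
  suffices ∀ h, ContinuousLinearMap.apply ℂ K (V h) ∘ₗ (ρ : neilAlgebra →ₗ[ℂ] K →L[ℂ] K) =
      V.toLinearMap ∘ₗ ContinuousLinearMap.apply ℂ H h ∘ₗ (π : neilAlgebra →ₗ[ℂ] H →L[ℂ] H) from
    fun a => ContinuousLinearMap.ext fun h => (LinearMap.congr_fun (this h) a).symm
  refine fun h => eq_of_eq_neilMonomial (hρ.continuous_apply (V h)) ?_ fun n hn => ?_
  · change Continuous fun a => V (π a h)
    simp_rw [hVadj]
    exact V.continuous.comp ((ContinuousLinearMap.continuous _).comp (hρ.continuous_apply (V h)))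
  · change ρ (neilMonomial hn) (V h) = V (π (neilMonomial hn) h)
    have hcontr : ‖ρ (neilMonomial hn) (V h)‖ ≤ ‖h‖ := by
      simpa using (ρ (neilMonomial hn)).le_of_opNorm_le
        ((hρ.norm_apply_le _).trans (norm_monomial_le n)) (V h)
    rw [hVadj, map_adjoint_eq_of_norm_le]
    rwa [← hVadj, hπ]

end Extremality

/-! ### The multiplication representations -/

section Multiplication

variable {N : Type*} [NormedAddCommGroup N] [InnerProductSpace ℂ N]

/-- In an orthonormal basis of the span of the `x j`, the inequality is the sum of the scalar
inequalities for the coordinates. -/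
theorem sum_norm_sq_sum_smul_le {ι κ : Type*} [Fintype ι] [Fintype κ] {A : ι → κ → ℂ} {C : ℝ}
    (hA : ∀ v : κ → ℂ, ∑ i, ‖∑ j, A i j * v j‖ ^ 2 ≤ C * ∑ j, ‖v j‖ ^ 2) (x : κ → N) :
    ∑ i, ‖∑ j, A i j • x j‖ ^ 2 ≤ C * ∑ j, ‖x j‖ ^ 2 := by
  let S := Submodule.span ℂ (Set.range x)
  have : FiniteDimensional ℂ S := FiniteDimensional.span_of_finite ℂ (Set.finite_range x)
  let b := stdOrthonormalBasis ℂ S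
  let y : κ → S := fun j => ⟨x j, Submodule.subset_span ⟨j, rfl⟩⟩
  have hparseval (s : S) : ‖(s : N)‖ ^ 2 = ∑ p, ‖⟪b p, s⟫_ℂ‖ ^ 2 :=
    (b.sum_sq_norm_inner_right s).symm
  have hx (j : κ) : ‖x j‖ ^ 2 = ∑ p, ‖⟪b p, y j⟫_ℂ‖ ^ 2 := hparseval (y j)
  have hAx (i : ι) : ‖∑ j, A i j • x j‖ ^ 2 = ∑ p, ‖∑ j, A i j * ⟪b p, y j⟫_ℂ‖ ^ 2 := by
    have hcoe : ∑ j, A i j • x j = ((∑ j, A i j • y j : S) : N) := by simp [y]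
    simp_rw [hcoe, hparseval, inner_sum, inner_smul_right]
  simp_rw [hAx, hx]
  rw [Finset.sum_comm, Finset.sum_comm (s := Finset.univ (α := κ)), Finset.mul_sum]
  exact Finset.sum_le_sum fun p _ => hA _

variable [CompleteSpace N]

theorem Hardy.ext_taylorCoeff {f g : Hardy N} (h : ∀ n, taylorCoeff f n = taylorCoeff g n) :
    f = g :=
  Hardy.coeffEquiv.injective (lp.ext (funext h))

theorem mulOp_monomial_apply (k : ℕ) (f : Hardy N) (z : ℂ) :
    mulOp (monomial_mem_discAlgebra k) f z = z ^ k • f z := by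
  rw [mulOp_apply]
  by_cases hz : z ∈ Metric.ball (0 : ℂ) 1
  · rw [discExt_monomial k (Metric.ball_subset_closedBall hz)]
  · rw [f.apply_eq_zero hz, smul_zero, smul_zero]

theorem mulOp_monomial_add (k n : ℕ) (f : Hardy N) :
    mulOp (monomial_mem_discAlgebra (k + n)) f =
      mulOp (monomial_mem_discAlgebra k) (mulOp (monomial_mem_discAlgebra n) f) :=
  Hardy.ext fun z _ => by simp_rw [mulOp_monomial_apply, smul_smul, pow_add]

theorem taylorCoeff_mulOp_monomial_add (k n : ℕ) (f : Hardy N) :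
    taylorCoeff (mulOp (monomial_mem_discAlgebra k) f) (n + k) = taylorCoeff f n := by
  have hhalf : (0 : ℝ) < 1 / 2 := by norm_num
  rw [← circleAverage_taylorCoeff (Hardy.differentiableOn _) hhalf one_half_lt_one,
    ← circleAverage_taylorCoeff f.differentiableOn hhalf one_half_lt_one]
  refine Real.circleAverage_congr_sphere fun z hz => ?_
  have hz0 : z ≠ 0 := ne_zero_of_mem_sphere (abs_pos.2 hhalf.ne').ne' ⟨z, hz⟩
  rw [mulOp_monomial_apply, smul_smul, pow_add]
  congr 1
  field_simp

theorem taylorCoeff_mulOp_monomial_of_lt {k n : ℕ} (hn : n < k) (f : Hardy N) :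
    taylorCoeff (mulOp (monomial_mem_discAlgebra k) f) n = 0 := by
  obtain ⟨m, rfl⟩ := Nat.exists_eq_add_of_lt hn
  have h := taylorCoeff_mulOp_monomial_add n 0 (mulOp (monomial_mem_discAlgebra (m + 1)) f)
  rw [← mulOp_monomial_add, zero_add, taylorCoeff_zero, mulOp_monomial_apply,
    zero_pow m.succ_ne_zero, zero_smul] at h
  exact h

theorem norm_mulOp_monomial (k : ℕ) (f : Hardy N) :
    ‖mulOp (monomial_mem_discAlgebra k) f‖ = ‖f‖ := by
  rw [← sq_eq_sq₀ (norm_nonneg _) (norm_nonneg _), Hardy.norm_sq_eq_tsum, Hardy.norm_sq_eq_tsum,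
    ← (Hardy.summable_coeff _).sum_add_tsum_nat_add k, Finset.sum_eq_zero, zero_add]
  · simp_rw [taylorCoeff_mulOp_monomial_add]
  · intro n hn
    rw [taylorCoeff_mulOp_monomial_of_lt (Finset.mem_range.1 hn), norm_zero, sq, zero_mul]

theorem monotoneOn_meanSq (f : Hardy N) : MonotoneOn (meanSq f) (Set.Ioo 0 1) :=
  fun _ hr _ hs hrs => hasSum_le (fun n => by have := hr.1; gcongr)
    (hasSum_meanSq f.differentiableOn hr.1 hr.2) (hasSum_meanSq f.differentiableOn hs.1 hs.2)

theorem tendsto_meanSq (f : Hardy N) :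
    Filter.Tendsto (meanSq f) (nhdsWithin 1 (Set.Ioo 0 1)) (nhds (‖f‖ ^ 2)) := by
  have hne : (Set.Ioo (0 : ℝ) 1).Nonempty := Set.nonempty_Ioo.2 one_pos
  rw [← f.isLUB_norm_sq.csSup_eq (hne.image _), nhdsWithin_Ioo_eq_nhdsLT one_pos]
  exact (monotoneOn_meanSq f).tendsto_nhdsWithin_Ioo_left hne f.isLUB_norm_sq.bddAbove

theorem circleIntegrable_norm_sq (f : Hardy N) {r : ℝ} (hr : r ∈ Set.Ioo (0 : ℝ) 1) :
    CircleIntegrable (fun z => ‖f z‖ ^ 2) 0 r :=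
  ((continuous_circle f.differentiableOn hr.1.le hr.2).norm.pow 2).intervalIntegrable _ _

/-- The Hardy space inequality is the limit `r → 1` of pointwise inequalities, integrated over the
circles of radius `r`. -/
theorem sum_norm_sq_sum_mulOp_le {n : ℕ} (F : Matrix (Fin n) (Fin n) neilAlgebra)
    (f : Fin n → Hardy N) :
    ∑ i, ‖∑ j, mulOp (F i j).2.1 (f j)‖ ^ 2 ≤ matrixNorm F ^ 2 * ∑ j, ‖f j‖ ^ 2 := by
  have : (nhdsWithin (1 : ℝ) (Set.Ioo 0 1)).NeBot := by
    rw [nhdsWithin_Ioo_eq_nhdsLT one_pos]; infer_instance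
  refine le_of_tendsto_of_tendsto
    (tendsto_finsetSum _ fun i _ => tendsto_meanSq (∑ j, mulOp (F i j).2.1 (f j)))
    ((tendsto_finsetSum _ fun j _ => tendsto_meanSq (f j)).const_mul _) ?_
  filter_upwards [self_mem_nhdsWithin] with r hr
  have hint (g : Hardy N) := circleIntegrable_norm_sq g hr
  simp only [meanSq]
  rw [← Real.circleAverage_fun_sum fun i _ => hint _,
    ← Real.circleAverage_fun_sum fun i _ => hint _, ← smul_eq_mul, ← Real.circleAverage_fun_smul]
  refine Real.circleAverage_mono (.fun_sum _ fun i _ => hint _)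
    (.const_fun_smul (.fun_sum _ fun i _ => hint _)) fun z hz => ?_
  have hzb : z ∈ Metric.closedBall (0 : ℂ) 1 := by
    rw [mem_closedBall_zero_iff, mem_sphere_zero_iff_norm.1 hz, abs_of_pos hr.1]
    exact hr.2.le
  have happ (i : Fin n) :
      (∑ j, mulOp (F i j).2.1 (f j)) z = ∑ j, evalAt ⟨z, hzb⟩ (F i j) • f j z := by
    simp_rw [evalAt_apply, ← discExt_of_mem _ hzb]
    exact map_sum (⟨⟨fun g : Hardy N => g z, rfl⟩, fun _ _ => rfl⟩ : Hardy N →+ N) _ _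
  simp only [happ, smul_eq_mul]
  exact sum_norm_sq_sum_smul_le (sum_norm_sq_sum_evalAt_mul_le ⟨z, hzb⟩ F) fun j => f j z

variable {V : Submodule ℂ (Hardy N)} (hV : V ≤ linearPart N)

theorem isUnital_mulRep : IsUnital (mulRep V hV) :=
  ContinuousLinearMap.ext fun f => Subtype.ext <| Hardy.ext fun z hz => by
    rw [mulRep_apply, discExt_of_mem _ (Metric.ball_subset_closedBall hz)]
    exact one_smul ℂ _

theorem isPure_mulRep : IsPure (mulRep V hV) := by
  refine Set.eq_singleton_iff_unique_mem.2 ⟨Set.mem_iInter₂.2 fun a _ => ⟨0, map_zero _⟩,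
    fun f hf => Subtype.ext (Hardy.ext_taylorCoeff fun n => ?_)⟩
  obtain ⟨g, rfl⟩ := Set.mem_iInter₂.1 hf (neilMonomial (n := n + 2) (by omega)) fun z hz => by
    rw [neilMonomial, discExt_monomial _ (mem_closedBall_zero_iff.2 hz.le)]
    exact pow_ne_zero _ (norm_ne_zero_iff.1 (hz ▸ one_ne_zero))
  have hzero := taylorCoeff_mulOp_monomial_of_lt (k := n + 2) (n := n) (by omega) (0 : Hardy N)
  rw [map_zero] at hzero
  exact (taylorCoeff_mulOp_monomial_of_lt (k := n + 2) (by omega) (g : Hardy N)).trans hzero.symm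

theorem isCompletelyContractive_mulRep : IsCompletelyContractive (mulRep V hV) := by
  refine isCompletelyContractive_iff_sum_norm_sq_le.2 fun n F f => ?_
  refine (Finset.sum_congr rfl fun i _ => ?_).trans_le
    (sum_norm_sq_sum_mulOp_le F fun j => (f j : Hardy N))
  rw [Submodule.coe_norm, AddSubmonoidClass.coe_finsetSum]
  rfl

theorem isExtremal_mulRep : IsExtremal (mulRep V hV) :=
  isExtremal_of_norm_apply_neilMonomial fun n _ f => norm_mulOp_monomial n (f : Hardy N)

end Multiplication

/-! ### Positivity of completely contractive representations -/

section Accretive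

variable {E : Type*} [NormedAddCommGroup E] [InnerProductSpace ℂ E] {A : E →L[ℂ] E}

theorem norm_sub_smul_sq (x y : E) (t : ℝ) :
    ‖x - (t : ℂ) • y‖ ^ 2 = ‖x‖ ^ 2 - 2 * t * RCLike.re ⟪x, y⟫_ℂ + t ^ 2 * ‖y‖ ^ 2 := by
  rw [norm_sub_sq (𝕜 := ℂ), inner_smul_right, norm_smul, mul_pow, Complex.norm_real,
    Real.norm_eq_abs, sq_abs]
  simp only [RCLike.re_to_complex, Complex.re_ofReal_mul]
  ring

theorem norm_one_sub_smul_le {C : ℝ} (hAC : ‖A‖ ≤ C) (hA : ∀ v, 0 ≤ RCLike.re ⟪v, A v⟫_ℂ) {t : ℝ}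
    (ht : 0 ≤ t) : ‖1 - (t : ℂ) • A‖ ≤ √(1 + t ^ 2 * C ^ 2) := by
  refine ContinuousLinearMap.opNorm_le_bound _ (Real.sqrt_nonneg _) fun v => ?_
  have hAv : ‖A v‖ ^ 2 ≤ (C * ‖v‖) ^ 2 :=
    pow_le_pow_left₀ (norm_nonneg _) (A.le_of_opNorm_le hAC v) 2
  refine le_of_sq_le_sq ?_ (by positivity)
  calc ‖v - (t : ℂ) • A v‖ ^ 2
      = ‖v‖ ^ 2 - 2 * t * RCLike.re ⟪v, A v⟫_ℂ + t ^ 2 * ‖A v‖ ^ 2 := norm_sub_smul_sq ..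
    _ ≤ ‖v‖ ^ 2 - 0 + t ^ 2 * (C * ‖v‖) ^ 2 := by gcongr; exact mul_nonneg (by positivity) (hA v)
    _ = (√(1 + t ^ 2 * C ^ 2) * ‖v‖) ^ 2 := by
        rw [mul_pow √(1 + t ^ 2 * C ^ 2), Real.sq_sqrt (by positivity)]
        ring

theorem re_inner_nonneg_of_norm_one_sub_smul_le {C : ℝ}
    (hA : ∀ t : ℝ, 0 < t → ‖1 - (t : ℂ) • A‖ ≤ √(1 + t ^ 2 * C ^ 2)) (v : E) :
    0 ≤ RCLike.re ⟪v, A v⟫_ℂ := by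
  set q := RCLike.re ⟪v, A v⟫_ℂ
  have hbound (t : ℝ) (ht : t ∈ Set.Ioi 0) : 0 ≤ 2 * q + t * (C ^ 2 * ‖v‖ ^ 2) := by
    have h : ‖v - (t : ℂ) • A v‖ ^ 2 ≤ (√(1 + t ^ 2 * C ^ 2) * ‖v‖) ^ 2 :=
      pow_le_pow_left₀ (norm_nonneg _) ((1 - (t : ℂ) • A).le_of_opNorm_le (hA t ht) v) 2
    rw [mul_pow, Real.sq_sqrt (by positivity), norm_sub_smul_sq] at h
    refine nonneg_of_mul_nonneg_right ?_ (Set.mem_Ioi.1 ht)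
    linarith [mul_nonneg (sq_nonneg t) (sq_nonneg ‖A v‖)]
  have hlim : Filter.Tendsto (fun t : ℝ => 2 * q + t * (C ^ 2 * ‖v‖ ^ 2))
      (nhdsWithin 0 (Set.Ioi 0)) (nhds (2 * q + 0 * (C ^ 2 * ‖v‖ ^ 2))) :=
    ContinuousWithinAt.tendsto (by fun_prop)
  linarith [ge_of_tendsto hlim (eventually_mem_nhdsWithin.mono hbound)]

end Accretive

section Positivity

variable {H : Type*} [NormedAddCommGroup H] [InnerProductSpace ℂ H]
  {ν : neilAlgebra →ₙₐ[ℂ] (H →L[ℂ] H)} {n : ℕ}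

theorem IsUnital.amplify_one_sub_smul (h1 : IsUnital ν) (c : ℂ)
    (F : Matrix (Fin n) (Fin n) neilAlgebra) :
    amplify ν (1 - c • F) = 1 - c • amplify ν F := by
  ext x i
  have hone (j : Fin n) : ν ((1 : Matrix (Fin n) (Fin n) neilAlgebra) i j) (x j) =
      if i = j then x j else 0 := by
    rw [Matrix.one_apply]
    split_ifs
    · rw [h1, one_apply_eq_self]
    · rw [map_zero, zero_apply]
  simp [amplify_apply, hone, Finset.smul_sum]

/-- Accretivity is detected by the norms `‖1 - tF‖` for small `t`, which complete contractivity
controls. -/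
theorem IsCompletelyContractive.re_inner_amplify_nonneg (hν : IsCompletelyContractive ν)
    (h1 : IsUnital ν) {F : Matrix (Fin n) (Fin n) neilAlgebra}
    (hF : ∀ (z : Circle) v, 0 ≤ RCLike.re ⟪v, evalMatrix (circleInclusion z) F v⟫_ℂ)
    (x : PiLp 2 fun _ : Fin n => H) : 0 ≤ RCLike.re ⟪x, amplify ν F x⟫_ℂ := by
  refine re_inner_nonneg_of_norm_one_sub_smul_le (C := matrixNorm F) (fun t ht => ?_) x
  rw [← h1.amplify_one_sub_smul]
  refine (hν n _).trans (matrixNorm_le_of_forall_circle fun z => ?_)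
  rw [map_sub, map_one, map_smul]
  exact norm_one_sub_smul_le (norm_evalMatrix_le _ F) (hF z) ht.le

variable {ι : Type*}

theorem inner_evalMatrix_sum_smul (z : Metric.closedBall (0 : ℂ) 1) (s : Finset ι)
    (u w : ι → Fin n → ℂ) (a : ι → neilAlgebra) (v : EuclideanSpace ℂ (Fin n)) :
    ⟪v, evalMatrix z (Matrix.of fun q p => ∑ i ∈ s, (u i q * w i p) • a i) v⟫_ℂ =
      ∑ i ∈ s, (∑ q, starRingEnd ℂ (v q) * u i q) * evalAt z (a i) * ∑ p, v p * w i p := by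
  have heval (q p : Fin n) : evalAt z (∑ i ∈ s, (u i q * w i p) • a i) =
      ∑ i ∈ s, u i q * w i p * evalAt z (a i) :=
    (map_sum (evalAt z) _ s).trans (Finset.sum_congr rfl fun i _ =>
      map_smul (evalAt z).toLinearMap _ _)
  simp only [PiLp.inner_apply, RCLike.inner_apply, evalMatrix_apply, Matrix.of_apply, heval,
    Finset.sum_mul, Finset.mul_sum]
  rw [Finset.sum_congr rfl fun q _ => Finset.sum_comm, Finset.sum_comm]
  refine Finset.sum_congr rfl fun i _ => ?_
  rw [Finset.sum_comm]
  refine Finset.sum_congr rfl fun p _ => Finset.sum_congr rfl fun q _ => ?_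
  ring

theorem inner_amplify_sum_smul (s : Finset ι)
    (u w : ι → Fin n → ℂ) (a : ι → neilAlgebra) (x : Fin n → H) :
    ⟪WithLp.toLp 2 x, amplify ν (Matrix.of fun q p => ∑ i ∈ s, (u i q * w i p) • a i)
        (WithLp.toLp 2 x)⟫_ℂ =
      ∑ i ∈ s, ⟪∑ q, starRingEnd ℂ (u i q) • x q, ν (a i) (∑ p, w i p • x p)⟫_ℂ := by
  simp only [PiLp.inner_apply, amplify_apply, Matrix.of_apply, map_sum, map_smul, sum_apply,
    smul_apply, inner_sum, sum_inner, inner_smul_left, inner_smul_right, Complex.conj_conj,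
    Finset.mul_sum]
  rw [Finset.sum_congr rfl fun q _ => Finset.sum_comm, Finset.sum_comm]
  refine Finset.sum_congr rfl fun i _ => ?_
  rw [Finset.sum_comm]
  refine Finset.sum_congr rfl fun p _ => Finset.sum_congr rfl fun q _ => ?_
  ring

/-- In an orthonormal basis of a subspace containing all `h i` and `h' i`, both sides are quadratic
forms of one matrix over the Neil algebra. -/
theorem IsCompletelyContractive.re_sum_inner_nonneg (hν : IsCompletelyContractive ν)
    (h1 : IsUnital ν) (s : Finset ι) (a : ι → neilAlgebra) (h h' : ι → H)
    (hpos : ∀ (z : Circle) k,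
      0 ≤ (∑ i ∈ s, ⟪h i, k⟫_ℂ * evalAt (circleInclusion z) (a i) * ⟪k, h' i⟫_ℂ).re) :
    0 ≤ (∑ i ∈ s, ⟪h i, ν (a i) (h' i)⟫_ℂ).re := by
  let E := Submodule.span ℂ (h '' s ∪ h' '' s)
  have : FiniteDimensional ℂ E := FiniteDimensional.span_of_finite ℂ
    ((s.finite_toSet.image h).union (s.finite_toSet.image h'))
  let b := stdOrthonormalBasis ℂ E
  have hexp (y : H) (hy : y ∈ E) : ∑ p, ⟪(b p : H), y⟫_ℂ • (b p : H) = y := by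
    simpa using congrArg Subtype.val (b.sum_repr' ⟨y, hy⟩)
  have hh (i) (hi : i ∈ s) : h i ∈ E := Submodule.subset_span (.inl ⟨i, hi, rfl⟩)
  have hh' (i) (hi : i ∈ s) : h' i ∈ E := Submodule.subset_span (.inr ⟨i, hi, rfl⟩)
  have key := hν.re_inner_amplify_nonneg h1
    (F := Matrix.of fun q p => ∑ i ∈ s, (⟪h i, (b q : H)⟫_ℂ * ⟪(b p : H), h' i⟫_ℂ) • a i)
    (fun z v => ?_) (WithLp.toLp 2 fun p => (b p : H))
  · rw [inner_amplify_sum_smul] at key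
    refine key.trans_eq (congrArg Complex.re (Finset.sum_congr rfl fun i hi => ?_))
    simp_rw [inner_conj_symm]
    rw [hexp _ (hh i hi), hexp _ (hh' i hi)]
  · rw [inner_evalMatrix_sum_smul]
    have hk := hpos z (∑ p, starRingEnd ℂ (v p) • (b p : H))
    simp_rw [inner_sum, sum_inner, inner_smul_left, inner_smul_right, Complex.conj_conj] at hk
    exact hk

end Positivity

/-! ### Extension of positive functionals -/

section Extension

variable {Z D : Type*} [AddCommGroup Z] [Module ℝ Z] [AddCommGroup D] [Module ℝ D]
  (P : PointedCone ℝ Z)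

/-- The Riesz extension theorem without cofinality: the theorem applies on the lineality space of
`P ⊔ f.domain`, which contains every element of `P` dominated by the domain. -/
theorem exists_extension_nonneg_of_dominated (f : Z →ₗ.[ℝ] ℝ)
    (hf : ∀ d : f.domain, (d : Z) ∈ P → 0 ≤ f d) :
    ∃ g : Z →ₗ[ℝ] ℝ, (∀ d : f.domain, g d = f d) ∧
      ∀ y ∈ P, ∀ d ∈ f.domain, d - y ∈ P → 0 ≤ g y := by
  let E := (P ⊔ f.domain.restrictScalars _ : PointedCone ℝ Z).lineal
  have hdomE : f.domain ≤ E := fun d hd =>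
    ⟨Submodule.mem_sup_right hd, Submodule.mem_sup_right (f.domain.neg_mem hd)⟩
  obtain ⟨g, hg, hgP⟩ := riesz_extension (P.comap E.subtype)
    ⟨f.domain.comap E.subtype, f.toFun ∘ₗ E.subtype.submoduleComap f.domain⟩
    (fun d hd => hf ⟨d, d.2⟩ hd) fun y => by
      obtain ⟨p, hp, d, hd, hpd⟩ := Submodule.mem_sup.1 y.2.1
      refine ⟨⟨⟨-d, hdomE (f.domain.neg_mem hd)⟩, f.domain.neg_mem hd⟩, ?_⟩
      change -d + (y : Z) ∈ P
      rwa [← hpd, neg_add_eq_sub, add_sub_cancel_right]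
  obtain ⟨g', rfl⟩ := LinearMap.exists_extend g
  refine ⟨g', fun d => hg ⟨⟨d, hdomE d.2⟩, d.2⟩, fun y hy d hd hdy => ?_⟩
  refine hgP ⟨y, Submodule.mem_sup_left hy,
    Submodule.mem_sup.2 ⟨_, hdy, -d, f.domain.neg_mem hd, ?_⟩⟩ hy
  abel

theorem exists_positive_extension (Λ : D →ₗ[ℝ] Z) (s : D →ₗ[ℝ] ℝ)
    (hs : ∀ d, Λ d ∈ P → 0 ≤ s d) :
    ∃ g : Z →ₗ[ℝ] ℝ, g ∘ₗ Λ = s ∧ ∀ y ∈ P, ∀ d ∈ LinearMap.range Λ, d - y ∈ P → 0 ≤ g y := by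
  have hker : s ∈ Λ.ker.dualAnnihilator := by
    refine (Submodule.mem_dualAnnihilator _).2 fun d hd => le_antisymm ?_ ?_
    · have := hs (-d) (by rw [map_neg, hd, neg_zero]; exact P.zero_mem)
      rwa [map_neg, neg_nonneg] at this
    · exact hs d (by rw [hd]; exact P.zero_mem)
  rw [← LinearMap.range_dualMap_eq_dualAnnihilator_ker] at hker
  obtain ⟨s', rfl⟩ := hker
  obtain ⟨g, hg, hgP⟩ := exists_extension_nonneg_of_dominated P
    ⟨LinearMap.range Λ, s'.domRestrict _⟩ (by rintro ⟨_, d, rfl⟩; exact hs d)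
  exact ⟨g, LinearMap.ext fun d => hg ⟨Λ d, d, rfl⟩, hgP⟩

end Extension

/-! ### Gelfand–Naimark–Segal construction for dominated functions -/

/-- A real functional on the functions on a set `Y` that is positive on the nonnegative functions
dominated by some element of the subspace `core`. -/
structure PositiveState (Y : Type*) where
  core : Submodule ℝ (Y → ℝ)
  functional : (Y → ℝ) →ₗ[ℝ] ℝ
  nonneg : ∀ f, 0 ≤ f → ∀ d ∈ core, f ≤ d → 0 ≤ functional f

theorem exists_positiveState {Y ι : Type*} (b : ι → Y → ℝ) (c : ι → ℝ)
    (h : ∀ d : ι →₀ ℝ, 0 ≤ Finsupp.linearCombination ℝ b d →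
      0 ≤ Finsupp.linearCombination ℝ c d) :
    ∃ φ : PositiveState Y, (∀ i, b i ∈ φ.core) ∧ ∀ i, φ.functional (b i) = c i := by
  obtain ⟨g, hg, hpos⟩ := exists_positive_extension (PointedCone.positive ℝ (Y → ℝ))
    (Finsupp.linearCombination ℝ b) (Finsupp.linearCombination ℝ c) h
  have hb (i : ι) : Finsupp.linearCombination ℝ b (Finsupp.single i 1) = b i := by
    rw [Finsupp.linearCombination_single, one_smul]
  refine ⟨⟨LinearMap.range (Finsupp.linearCombination ℝ b), g,
    fun f hf d hd hfd => hpos f hf d hd (sub_nonneg.2 hfd)⟩, fun i => ⟨_, hb i⟩, fun i => ?_⟩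
  rw [← hb, ← LinearMap.comp_apply, hg, Finsupp.linearCombination_single, one_smul]

namespace PositiveState

section Construction

variable {Y : Type*} (φ : PositiveState Y)

theorem functional_mono {f g d : Y → ℝ} (hd : d ∈ φ.core) (hf : 0 ≤ f) (hfg : f ≤ g) (hgd : g ≤ d) :
    φ.functional f ≤ φ.functional g := by
  rw [← sub_nonneg, ← map_sub]
  exact φ.nonneg _ (sub_nonneg.2 hfg) d hd ((sub_le_self g hf).trans hgd)

/-- The complex linear extension of a positive functional. -/
def complexFunctional : (Y → ℂ) →ₗ[ℂ] ℂ :=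
  Module.Dual.extendRCLike (φ.functional ∘ₗ Complex.reLm.compLeft Y)

theorem re_complexFunctional (f : Y → ℂ) :
    (φ.complexFunctional f).re = φ.functional fun y => (f y).re :=
  Module.Dual.re_extendRCLike_apply (𝕜 := ℂ) _ f

theorem im_complexFunctional (f : Y → ℂ) :
    (φ.complexFunctional f).im = φ.functional fun y => (f y).im := by
  refine (Module.Dual.im_extendRCLike_apply (𝕜 := ℂ) _ f).trans ?_
  rw [← map_neg]
  refine congrArg φ.functional (funext fun y => ?_)
  change (-(Complex.I * f y)).re = (f y).im
  rw [Complex.neg_re, Complex.I_mul_re, neg_neg]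

theorem complexFunctional_star (f : Y → ℂ) :
    φ.complexFunctional (star f) = star (φ.complexFunctional f) := by
  apply Complex.ext
  · rw [Complex.star_def, Complex.conj_re, re_complexFunctional, re_complexFunctional]
    rfl
  · rw [Complex.star_def, Complex.conj_im, im_complexFunctional, im_complexFunctional, ← map_neg]
    rfl

theorem re_complexFunctional_star_mul_self (f : Y → ℂ) :
    (φ.complexFunctional (star f * f)).re = φ.functional fun y => ‖f y‖ ^ 2 := by
  refine (φ.re_complexFunctional _).trans (congrArg _ (funext fun y => ?_))
  rw [Pi.mul_apply, Pi.star_apply, Complex.star_def, Complex.conj_mul', ← Complex.ofReal_pow,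
    Complex.ofReal_re]

/-- The functions whose squared modulus is dominated by an element of the core. -/
def domain : Submodule ℂ (Y → ℂ) where
  carrier := {f | ∃ d ∈ φ.core, ∀ y, ‖f y‖ ^ 2 ≤ d y}
  zero_mem' := ⟨0, zero_mem _, fun y => by simp⟩
  add_mem' := by
    rintro f g ⟨d, hd, hfd⟩ ⟨e, he, hge⟩
    refine ⟨(2 : ℝ) • (d + e), Submodule.smul_mem _ _ (add_mem hd he), fun y => ?_⟩
    calc ‖f y + g y‖ ^ 2 ≤ (‖f y‖ + ‖g y‖) ^ 2 := by gcongr; exact norm_add_le _ _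
      _ ≤ 2 * (‖f y‖ ^ 2 + ‖g y‖ ^ 2) := add_sq_le
      _ ≤ 2 * (d y + e y) := by gcongr; exacts [hfd y, hge y]
  smul_mem' := by
    rintro c f ⟨d, hd, hfd⟩
    refine ⟨(‖c‖ ^ 2) • d, Submodule.smul_mem _ _ hd, fun y => ?_⟩
    rw [Pi.smul_apply, smul_eq_mul, norm_mul, mul_pow]
    exact mul_le_mul_of_nonneg_left (hfd y) (sq_nonneg _)

/-- The domain of a positive state, with the semi-inner product `φ (star f * g)`. -/
def PreGNS : Type _ := φ.domain

instance : AddCommGroup φ.PreGNS := inferInstanceAs (AddCommGroup φ.domain)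
instance : Module ℂ φ.PreGNS := inferInstanceAs (Module ℂ φ.domain)

/-- The function underlying an element of the domain. -/
def toFun : φ.PreGNS →ₗ[ℂ] (Y → ℂ) := φ.domain.subtype

theorem toFun_injective : Function.Injective φ.toFun := φ.domain.subtype_injective

/-- The semi-inner product of the Gelfand–Naimark–Segal construction. -/
@[reducible]
def preInnerCore : PreInnerProductSpace.Core ℂ φ.PreGNS where
  inner f g := φ.complexFunctional (star (φ.toFun f) * φ.toFun g)
  conj_inner_symm f g := by
    rw [starRingEnd_apply, ← complexFunctional_star, star_mul, star_star]
  re_inner_nonneg f := by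
    obtain ⟨d, hd, hfd⟩ := f.2
    exact (φ.nonneg _ (fun y => sq_nonneg _) d hd hfd).trans_eq
      (φ.re_complexFunctional_star_mul_self _).symm
  add_left f g h := by rw [map_add, star_add, add_mul, map_add]
  smul_left f g c := by rw [map_smul, star_smul, smul_mul_assoc, map_smul]; rfl

instance : SeminormedAddCommGroup φ.PreGNS :=
  @InnerProductSpace.Core.toSeminormedAddCommGroup ℂ φ.PreGNS _ _ _ φ.preInnerCore

instance : InnerProductSpace ℂ φ.PreGNS := InnerProductSpace.ofCore φ.preInnerCore

theorem inner_eq (f g : φ.PreGNS) :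
    ⟪f, g⟫_ℂ = φ.complexFunctional (star (φ.toFun f) * φ.toFun g) := rfl

theorem norm_sq_eq (f : φ.PreGNS) : ‖f‖ ^ 2 = φ.functional fun y => ‖φ.toFun f y‖ ^ 2 := by
  rw [@norm_sq_eq_re_inner ℂ, inner_eq]
  exact φ.re_complexFunctional_star_mul_self _

theorem sum_norm_sq_le_sum_norm_sq {ι κ : Type*} [Fintype ι] [Fintype κ] (f : ι → φ.PreGNS)
    (g : κ → φ.PreGNS)
    (h : ∀ y, ∑ i, ‖φ.toFun (f i) y‖ ^ 2 ≤ ∑ j, ‖φ.toFun (g j) y‖ ^ 2) :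
    ∑ i, ‖f i‖ ^ 2 ≤ ∑ j, ‖g j‖ ^ 2 := by
  choose d hd hgd using fun j => (g j).2
  simp_rw [norm_sq_eq, ← map_sum]
  refine φ.functional_mono (sum_mem fun j _ => hd j) (Finset.sum_nonneg fun i _ y => sq_nonneg _)
    (fun y => ?_) (Finset.sum_le_sum fun j _ y => hgd j y)
  rw [Finset.sum_apply, Finset.sum_apply]
  exact h y

/-- The Hilbert space of the Gelfand–Naimark–Segal construction. -/
abbrev GNS : Type _ := UniformSpace.Completion φ.PreGNS

theorem gns_ext {S T : φ.GNS →L[ℂ] φ.GNS} (h : ∀ f : φ.PreGNS, S f = T f) : S = T :=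
  ContinuousLinearMap.ext fun x =>
    congrFun (UniformSpace.Completion.ext S.continuous T.continuous h) x

end Construction

section Multiplication

variable {X Z : Type*} [TopologicalSpace X] [CompactSpace X] (φ : PositiveState (X × Z))

theorem comp_fst_mul_mem_domain (c : C(X, ℂ)) {f : X × Z → ℂ} (hf : f ∈ φ.domain) :
    (c ∘ Prod.fst) * f ∈ φ.domain := by
  obtain ⟨d, hd, hfd⟩ := hf
  refine ⟨‖c‖ ^ 2 • d, Submodule.smul_mem _ _ hd, fun y => ?_⟩
  rw [Pi.mul_apply, norm_mul, mul_pow, Pi.smul_apply, smul_eq_mul]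
  gcongr
  exacts [c.norm_coe_le_norm y.1, hfd y]

/-- Multiplication by a continuous function of the first variable. -/
def mulFst : C(X, ℂ) →ₐ[ℂ] Module.End ℂ φ.PreGNS where
  toFun c :=
    { toFun f := ⟨(c ∘ Prod.fst) * φ.toFun f, φ.comp_fst_mul_mem_domain c f.2⟩
      map_add' _ _ := φ.toFun_injective (mul_add _ _ _)
      map_smul' _ _ := φ.toFun_injective (mul_smul_comm _ _ _) }
  map_one' := LinearMap.ext fun _ => φ.toFun_injective (one_mul _)
  map_mul' _ _ := LinearMap.ext fun _ => φ.toFun_injective (mul_assoc _ _ _)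
  map_zero' := LinearMap.ext fun _ => φ.toFun_injective (zero_mul _)
  map_add' _ _ := LinearMap.ext fun _ => φ.toFun_injective (add_mul _ _ _)
  commutes' _ := LinearMap.ext fun _ => φ.toFun_injective rfl

theorem toFun_mulFst (c : C(X, ℂ)) (f : φ.PreGNS) (y : X × Z) :
    φ.toFun (φ.mulFst c f) y = c y.1 * φ.toFun f y := rfl

theorem inner_mulFst_left (c : C(X, ℂ)) (f g : φ.PreGNS) :
    ⟪φ.mulFst c f, g⟫_ℂ = ⟪f, φ.mulFst (star c) g⟫_ℂ := by
  rw [inner_eq, inner_eq]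
  refine congrArg _ (funext fun y => ?_)
  simp only [Pi.mul_apply, Pi.star_apply, toFun_mulFst, star_mul', ContinuousMap.star_apply]
  ring

theorem norm_mulFst_le (c : C(X, ℂ)) (f : φ.PreGNS) : ‖φ.mulFst c f‖ ≤ ‖c‖ * ‖f‖ := by
  have h := φ.sum_norm_sq_le_sum_norm_sq (fun _ : Unit => φ.mulFst c f)
    (fun _ : Unit => (‖c‖ : ℂ) • f) fun y => by
      simp only [Finset.univ_unique, Finset.sum_singleton, toFun_mulFst, map_smul, Pi.smul_apply,
        smul_eq_mul, norm_mul, Complex.norm_real, norm_norm]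
      gcongr
      exact c.norm_coe_le_norm y.1
  simp only [Finset.univ_unique, Finset.sum_singleton, norm_smul, Complex.norm_real,
    norm_norm] at h
  exact le_of_sq_le_sq h (by positivity)

/-- Multiplication by a continuous function of the first variable on the completion. -/
def gnsMul (c : C(X, ℂ)) : φ.GNS →L[ℂ] φ.GNS :=
  ((φ.mulFst c).mkContinuous ‖c‖ (φ.norm_mulFst_le c)).completion

theorem gnsMul_coe (c : C(X, ℂ)) (f : φ.PreGNS) :
    φ.gnsMul c (f : φ.GNS) = (φ.mulFst c f : φ.GNS) :=
  ContinuousLinearMap.completion_apply_coe _ f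

theorem gnsMul_star (c : C(X, ℂ)) : φ.gnsMul (star c) = (φ.gnsMul c).adjoint := by
  refine (ContinuousLinearMap.eq_adjoint_iff _ _).2 fun x y => ?_
  induction x, y using UniformSpace.Completion.induction_on₂ with
  | hp => exact isClosed_eq (by fun_prop) (by fun_prop)
  | ih f g =>
    rw [gnsMul_coe, gnsMul_coe, UniformSpace.Completion.inner_coe,
      UniformSpace.Completion.inner_coe, inner_mulFst_left, star_star]

/-- The representation of the continuous functions by multiplication operators. -/
def gnsRep : C(X, ℂ) →⋆ₐ[ℂ] (φ.GNS →L[ℂ] φ.GNS) where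
  toFun := φ.gnsMul
  map_one' := φ.gns_ext fun f => by rw [gnsMul_coe, map_one]; rfl
  map_mul' c c' := φ.gns_ext fun f => by
    rw [mul_apply_eq_comp, gnsMul_coe, gnsMul_coe, gnsMul_coe, map_mul]; rfl
  map_zero' := φ.gns_ext fun f => by
    rw [gnsMul_coe, map_zero, LinearMap.zero_apply, UniformSpace.Completion.coe_zero]; rfl
  map_add' c c' := φ.gns_ext fun f => by
    rw [add_apply, gnsMul_coe, gnsMul_coe, gnsMul_coe, map_add,
      LinearMap.add_apply, UniformSpace.Completion.coe_add]
  commutes' r := φ.gns_ext fun f => by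
    rw [gnsMul_coe, AlgHom.commutes]
    exact UniformSpace.Completion.coe_smul r f
  map_star' := φ.gnsMul_star

theorem gnsRep_coe (c : C(X, ℂ)) (f : φ.PreGNS) :
    φ.gnsRep c (f : φ.GNS) = (φ.mulFst c f : φ.GNS) :=
  φ.gnsMul_coe c f

theorem sum_norm_sq_sum_gnsRep_le {ι κ : Type*} [Fintype ι] [Fintype κ] (F : ι → κ → C(X, ℂ))
    {C : ℝ} (hC : 0 ≤ C)
    (hF : ∀ x (v : κ → ℂ), ∑ i, ‖∑ j, F i j x * v j‖ ^ 2 ≤ C ^ 2 * ∑ j, ‖v j‖ ^ 2) (x : κ → φ.GNS) :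
    ∑ i, ‖∑ j, φ.gnsRep (F i j) (x j)‖ ^ 2 ≤ C ^ 2 * ∑ j, ‖x j‖ ^ 2 := by
  have hdense : DenseRange (Pi.map fun (_ : κ) (f : φ.PreGNS) => (f : φ.GNS)) :=
    DenseRange.piMap fun _ => UniformSpace.Completion.denseRange_coe
  refine isClosed_property hdense (p := fun x : κ → φ.GNS =>
    ∑ i, ‖∑ j, φ.gnsRep (F i j) (x j)‖ ^ 2 ≤ C ^ 2 * ∑ j, ‖x j‖ ^ 2)
    (isClosed_le (by fun_prop) (by fun_prop)) (fun f => ?_) x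
  have hcoe (i : ι) : ∑ j, φ.gnsRep (F i j) (f j : φ.GNS)
      = ((∑ j, φ.mulFst (F i j) (f j) : φ.PreGNS) : φ.GNS) :=
    (Finset.sum_congr rfl fun j _ => φ.gnsRep_coe (F i j) (f j)).trans
      (map_sum (UniformSpace.Completion.toComplₗᵢ (𝕜 := ℂ) (E := φ.PreGNS)) _ _).symm
  have h := φ.sum_norm_sq_le_sum_norm_sq (fun i => ∑ j, φ.mulFst (F i j) (f j))
    (fun j => (C : ℂ) • f j) fun y => by
      simpa only [map_sum, Finset.sum_apply, toFun_mulFst, map_smul, Pi.smul_apply, smul_eq_mul,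
        norm_mul, Complex.norm_real, Real.norm_of_nonneg hC, mul_pow, ← Finset.mul_sum]
        using hF y.1 fun j => φ.toFun (f j) y
  simpa only [Pi.map_apply, hcoe, UniformSpace.Completion.norm_coe, norm_smul, Complex.norm_real,
    Real.norm_of_nonneg hC, mul_pow, ← Finset.mul_sum] using h

end Multiplication

end PositiveState

/-! ### Dilation to the circle -/

/-- The boundary values of a function in the Neil algebra. -/
def boundaryValues : neilAlgebra →ₐ[ℂ] C(Circle, ℂ) :=
  (ContinuousMap.compRightAlgHom ℂ ℂ circleInclusion).comp neilAlgebra.val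

theorem boundaryValues_apply (a : neilAlgebra) (z : Circle) :
    boundaryValues a z = discExt (a : C(_, ℂ)) z := (discExt_of_mem _ (circleInclusion z).2).symm

section BoundaryRep

variable {K : Type*} [NormedAddCommGroup K] [InnerProductSpace ℂ K] [CompleteSpace K]

/-- The restriction to the Neil algebra of a representation of the continuous functions on the
circle. -/
def boundaryRep (M : C(Circle, ℂ) →⋆ₐ[ℂ] (K →L[ℂ] K)) : neilAlgebra →ₙₐ[ℂ] (K →L[ℂ] K) :=
  (M.toAlgHom.comp boundaryValues : neilAlgebra →ₐ[ℂ] (K →L[ℂ] K))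

theorem boundaryRep_apply (M : C(Circle, ℂ) →⋆ₐ[ℂ] (K →L[ℂ] K)) (a : neilAlgebra) :
    boundaryRep M a = M (boundaryValues a) := rfl

theorem PositiveState.isCompletelyContractive_boundaryRep_gnsRep {Z : Type*}
    (φ : PositiveState (Circle × Z)) : IsCompletelyContractive (boundaryRep φ.gnsRep) :=
  isCompletelyContractive_iff_sum_norm_sq_le.2 fun _ F =>
    φ.sum_norm_sq_sum_gnsRep_le (fun i j => boundaryValues (F i j)) (matrixNorm_nonneg F)
      fun z => sum_norm_sq_sum_evalAt_mul_le (circleInclusion z) F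

end BoundaryRep

section Compression

variable {H : Type*} [NormedAddCommGroup H] [InnerProductSpace ℂ H]

/-- The conjugate linear functional `k ↦ ⟪k, h⟫`, as a function on `Circle × H` that does not depend
on the first variable. -/
def coefficient : H →ₗ[ℂ] (Circle × H → ℂ) where
  toFun h y := ⟪y.2, h⟫_ℂ
  map_add' _ _ := funext fun _ => inner_add_right _ _ _
  map_smul' _ _ := funext fun _ => inner_smul_right _ _ _

/-- The sesquilinear form `(h, h') ↦ ⟪h, k⟫ * a z * ⟪k, h'⟫`, as a function of `(z, k)`. -/
def weightedCoefficient (h : H) (a : C(Circle, ℂ)) (h' : H) : Circle × H → ℂ :=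
  fun y => ⟪h, y.2⟫_ℂ * a y.1 * ⟪y.2, h'⟫_ℂ

theorem star_coefficient_mul (h : H) (a : C(Circle, ℂ)) (h' : H) :
    star (coefficient h) * ((a ∘ Prod.fst) * coefficient h') = weightedCoefficient h a h' :=
  funext fun y => by
    change starRingEnd ℂ ⟪y.2, h⟫_ℂ * (a y.1 * ⟪y.2, h'⟫_ℂ) = _
    rw [inner_conj_symm, ← mul_assoc]
    rfl

theorem re_weightedCoefficient_one (h : H) (y : Circle × H) :
    (weightedCoefficient h 1 h y).re = ‖coefficient h y‖ ^ 2 := by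
  change (⟪h, y.2⟫_ℂ * 1 * ⟪y.2, h⟫_ℂ).re = ‖⟪y.2, h⟫_ℂ‖ ^ 2
  rw [mul_one, ← inner_conj_symm, Complex.conj_mul', ← Complex.ofReal_pow, Complex.ofReal_re]

theorem weightedCoefficient_smul (c : ℂ) (h : H) (a : C(Circle, ℂ)) (h' : H) :
    weightedCoefficient h a (c • h') = c • weightedCoefficient h a h' :=
  funext fun y => by
    simp only [weightedCoefficient, inner_smul_right, Pi.smul_apply, smul_eq_mul]
    ring

namespace IsCompletelyContractive

variable {ν : neilAlgebra →ₙₐ[ℂ] (H →L[ℂ] H)}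

theorem exists_functional_weightedCoefficient (hν : IsCompletelyContractive ν) (h1 : IsUnital ν) :
    ∃ φ : PositiveState (Circle × H), ∀ a h h',
      (fun y => (weightedCoefficient h (boundaryValues a) h' y).re) ∈ φ.core ∧
      φ.functional (fun y => (weightedCoefficient h (boundaryValues a) h' y).re) =
        (⟪h, ν a h'⟫_ℂ).re := by
  suffices h : ∀ d : neilAlgebra × H × H →₀ ℝ,
      0 ≤ Finsupp.linearCombination ℝ
        (fun i y => (weightedCoefficient i.2.1 (boundaryValues i.1) i.2.2 y).re) d →
      0 ≤ Finsupp.linearCombination ℝ (fun i => (⟪i.2.1, ν i.1 i.2.2⟫_ℂ).re) d by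
    obtain ⟨φ, hφ, hφν⟩ := exists_positiveState _ _ h
    exact ⟨φ, fun a h h' => ⟨hφ (a, h, h'), hφν (a, h, h')⟩⟩
  intro d hd
  have hpos := hν.re_sum_inner_nonneg h1 d.support (fun i => i.1) (fun i => i.2.1)
    (fun i => (d i : ℂ) • i.2.2) fun z k => by
      refine (hd (z, k)).trans_eq ?_
      rw [Finsupp.linearCombination_apply, Finsupp.sum, Finset.sum_apply, Complex.re_sum]
      refine Finset.sum_congr rfl fun i _ => ?_
      rw [inner_smul_right, mul_left_comm, Complex.re_ofReal_mul]
      rfl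
  refine hpos.trans_eq ?_
  rw [Finsupp.linearCombination_apply, Finsupp.sum, Complex.re_sum]
  refine Finset.sum_congr rfl fun i _ => ?_
  rw [map_smul, inner_smul_right, Complex.re_ofReal_mul]
  rfl

theorem exists_complexFunctional_weightedCoefficient (hν : IsCompletelyContractive ν)
    (h1 : IsUnital ν) :
    ∃ φ : PositiveState (Circle × H), (∀ h, coefficient h ∈ φ.domain) ∧ ∀ a h h',
      φ.complexFunctional (weightedCoefficient h (boundaryValues a) h') = ⟪h, ν a h'⟫_ℂ := by
  obtain ⟨φ, hφ⟩ := hν.exists_functional_weightedCoefficient h1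
  have hre (a h h') : (φ.complexFunctional (weightedCoefficient h (boundaryValues a) h')).re =
      (⟪h, ν a h'⟫_ℂ).re := (φ.re_complexFunctional _).trans (hφ a h h').2
  refine ⟨φ, fun h => ⟨_, (hφ 1 h h).1, fun y => ?_⟩, fun a h h' => Complex.ext (hre a h h') ?_⟩
  · rw [map_one, re_weightedCoefficient_one]
  · have hI := hre a h (Complex.I • h')
    rw [weightedCoefficient_smul, map_smul, map_smul, inner_smul_right, smul_eq_mul,
      Complex.I_mul_re, Complex.I_mul_re] at hI
    exact neg_injective hI

theorem exists_dilation {H : Type w} [NormedAddCommGroup H] [InnerProductSpace ℂ H]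
    [CompleteSpace H] {ν : neilAlgebra →ₙₐ[ℂ] (H →L[ℂ] H)} (hν : IsCompletelyContractive ν)
    (h1 : IsUnital ν) :
    ∃ (K : Type w) (_ : NormedAddCommGroup K) (_ : InnerProductSpace ℂ K) (_ : CompleteSpace K)
      (M : C(Circle, ℂ) →⋆ₐ[ℂ] (K →L[ℂ] K)) (V : H →ₗᵢ[ℂ] K),
      IsCompletelyContractive (boundaryRep M) ∧
      ∀ a, ν a = V.toContinuousLinearMap.adjoint ∘L boundaryRep M a ∘L V.toContinuousLinearMap := by
  obtain ⟨φ, hdom, hφ⟩ := hν.exists_complexFunctional_weightedCoefficient h1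
  let V₀ : H →ₗ[ℂ] φ.GNS :=
    (UniformSpace.Completion.toComplₗᵢ (𝕜 := ℂ) (E := φ.PreGNS)).toLinearMap ∘ₗ
      coefficient.codRestrict φ.domain hdom
  have hinner (a h h') : ⟪V₀ h, boundaryRep φ.gnsRep a (V₀ h')⟫_ℂ = ⟪h, ν a h'⟫_ℂ := by
    refine (congrArg _ (φ.gnsRep_coe _ _)).trans ((UniformSpace.Completion.inner_coe _ _).trans ?_)
    rw [← hφ, ← star_coefficient_mul]
    rfl
  let V : H →ₗᵢ[ℂ] φ.GNS := V₀.isometryOfInner fun h h' => by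
    have h1' := hinner 1 h h'
    rwa [h1, boundaryRep_apply, map_one, map_one] at h1'
  refine ⟨φ.GNS, inferInstance, inferInstance, inferInstance, φ.gnsRep, V,
    φ.isCompletelyContractive_boundaryRep_gnsRep, fun a => ?_⟩
  refine ContinuousLinearMap.ext fun h' => ext_inner_left ℂ fun h => ?_
  rw [← hinner]
  exact (V.toContinuousLinearMap.adjoint_inner_right h (boundaryRep φ.gnsRep a (V h'))).symm

end IsCompletelyContractive

end Compression

/-! ### The Wold decomposition of a pure isometry -/

section Wold

variable {K : Type*} [NormedAddCommGroup K] [InnerProductSpace ℂ K] (U : K →ₗᵢ[ℂ] K)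

/-- The wandering subspace of an isometry: the orthogonal complement of its range. -/
abbrev wandering : Submodule ℂ K := U.toLinearMap.rangeᗮ

/-- The embeddings `U ^ n` of the wandering subspace. -/
def wanderingEmbedding (n : ℕ) : wandering U →ₗᵢ[ℂ] K := (U ^ n).comp (wandering U).subtypeₗᵢ

theorem inner_wanderingEmbedding_of_lt {m n : ℕ} (hmn : m < n) (v w : wandering U) :
    ⟪wanderingEmbedding U m v, wanderingEmbedding U n w⟫_ℂ = 0 := by
  obtain ⟨k, rfl⟩ := Nat.exists_eq_add_of_lt hmn
  change ⟪(U ^ m) v, (U ^ (m + k + 1)) w⟫_ℂ = 0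
  rw [add_assoc, pow_add]
  change ⟪(U ^ m) v, (U ^ m) ((U ^ (k + 1)) w)⟫_ℂ = 0
  rw [LinearIsometry.inner_map_map, pow_succ']
  exact Submodule.inner_left_of_mem_orthogonal (K := U.toLinearMap.range) ⟨(U ^ k) w, rfl⟩ v.2

theorem orthogonalFamily_wanderingEmbedding :
    OrthogonalFamily ℂ (fun _ : ℕ => wandering U) (wanderingEmbedding U) := by
  intro m n hmn v w
  rcases lt_or_gt_of_ne hmn with h | h
  · exact inner_wanderingEmbedding_of_lt U h v w
  · exact inner_eq_zero_symm.1 (inner_wanderingEmbedding_of_lt U h w v)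

variable [CompleteSpace K] {U}

theorem mem_range_pow_of_forall_inner_eq_zero {x : K}
    (hx : ∀ n w, ⟪wanderingEmbedding U n w, x⟫_ℂ = 0) (n : ℕ) :
    x ∈ (U ^ n).toLinearMap.range := by
  have hU : CompleteSpace U.toLinearMap.range :=
    U.isometry.isUniformInducing.isComplete_range.completeSpace_coe
  induction n with
  | zero => exact ⟨x, rfl⟩
  | succ n ih =>
    obtain ⟨y, rfl⟩ := ih
    have hy : y ∈ U.toLinearMap.rangeᗮᗮ := fun w hw =>
      ((U ^ n).inner_map_map w y).symm.trans (hx n ⟨w, hw⟩)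
    rw [Submodule.orthogonal_orthogonal] at hy
    obtain ⟨y', rfl⟩ := hy
    exact ⟨y', by rw [pow_succ]; rfl⟩

theorem isHilbertSum_wanderingEmbedding (hU : ⨅ n : ℕ, (U ^ n).toLinearMap.range = ⊥) :
    IsHilbertSum ℂ (fun _ : ℕ => wandering U) (wanderingEmbedding U) := by
  refine .mk (orthogonalFamily_wanderingEmbedding U) (top_le_iff.2 ?_)
  rw [Submodule.topologicalClosure_eq_top_iff, eq_bot_iff, ← hU]
  refine fun x hx => (Submodule.mem_iInf _).2 (mem_range_pow_of_forall_inner_eq_zero fun n w => ?_)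
  exact hx _ (Submodule.mem_iSup_of_mem n (LinearMap.mem_range_self _ w))

/-- A pure isometry is unitarily equivalent to multiplication by `z` on the Hardy space of its
wandering subspace. -/
def woldEquiv (hU : ⨅ n : ℕ, (U ^ n).toLinearMap.range = ⊥) : Hardy (wandering U) ≃ₗᵢ[ℂ] K :=
  Hardy.coeffIsometry.trans (isHilbertSum_wanderingEmbedding hU).linearIsometryEquiv.symm

theorem hasSum_woldEquiv (hU : ⨅ n : ℕ, (U ^ n).toLinearMap.range = ⊥)
    (f : Hardy (wandering U)) :
    HasSum (fun n => (U ^ n) ((taylorCoeff f n : wandering U) : K)) (woldEquiv hU f) :=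
  (isHilbertSum_wanderingEmbedding hU).hasSum_linearIsometryEquiv_symm (Hardy.coeffIsometry f)

theorem woldEquiv_mulOp_monomial (hU : ⨅ n : ℕ, (U ^ n).toLinearMap.range = ⊥) (k : ℕ)
    (f : Hardy (wandering U)) :
    woldEquiv hU (mulOp (monomial_mem_discAlgebra k) f) = (U ^ k) (woldEquiv hU f) := by
  have hterm (n : ℕ) : (U ^ (n + k))
      ((taylorCoeff (mulOp (monomial_mem_discAlgebra k) f) (n + k) : wandering U) : K) =
        (U ^ k) ((U ^ n) ((taylorCoeff f n : wandering U) : K)) := by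
    rw [taylorCoeff_mulOp_monomial_add, add_comm, pow_add]
    rfl
  have hshift := (hasSum_nat_add_iff' k).2
    (hasSum_woldEquiv hU (mulOp (monomial_mem_discAlgebra k) f))
  rw [Finset.sum_eq_zero fun n hn => by
    rw [taylorCoeff_mulOp_monomial_of_lt (Finset.mem_range.1 hn), ZeroMemClass.coe_zero, map_zero],
    sub_zero] at hshift
  simp only [hterm] at hshift
  exact hshift.unique ((hasSum_woldEquiv hU f).mapL (U ^ k).toContinuousLinearMap)

end Wold

/-! ### Invariant subspaces of representations of the continuous functions on the circle -/

/-- The coordinate function on the circle. -/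
def circleCoord : C(Circle, ℂ) := ⟨fun z => z, by fun_prop⟩

theorem boundaryValues_neilMonomial {n : ℕ} (hn : n ≠ 1) :
    boundaryValues (neilMonomial hn) = circleCoord ^ n :=
  ContinuousMap.ext fun _ => rfl

theorem star_circleCoord_mul_self : star circleCoord * circleCoord = 1 :=
  ContinuousMap.ext fun z => by
    change starRingEnd ℂ z * z = 1
    rw [Complex.conj_mul', Circle.norm_coe, Complex.ofReal_one, one_pow]

theorem circleCoord_mem_unitary : circleCoord ∈ unitary C(Circle, ℂ) :=
  Unitary.mem_iff.2 ⟨star_circleCoord_mul_self, (mul_comm _ _).trans star_circleCoord_mul_self⟩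

theorem induction_circleCoord {p : C(Circle, ℂ) → Prop} (const : ∀ c, p (.const _ c))
    (coord : p circleCoord) (star_coord : p (star circleCoord))
    (add : ∀ f g, p f → p g → p (f + g)) (mul : ∀ f g, p f → p g → p (f * g))
    (closed : IsClosed {f | p f}) (f : C(Circle, ℂ)) : p f :=
  have : CompactSpace (Submonoid.unitSphere ℂ : Set ℂ) := inferInstanceAs (CompactSpace Circle)
  ContinuousMap.induction_on_of_compact (s := (Submonoid.unitSphere ℂ : Set ℂ)) const coord
    star_coord add mul (fun _ h => closed.mem_of_frequently_of_tendsto h Filter.tendsto_id) f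

section CircleRepresentation

variable {K : Type*} [NormedAddCommGroup K] [InnerProductSpace ℂ K] [CompleteSpace K]

section CoordIsometry

variable (M : C(Circle, ℂ) →⋆ₐ[ℂ] (K →L[ℂ] K))

/-- The isometry of `K` given by the coordinate function on the circle. -/
def coordIsometry : K →ₗᵢ[ℂ] K where
  toLinearMap := M circleCoord
  norm_map' :=
    ContinuousLinearMap.norm_map_of_mem_unitary (Unitary.map_mem M circleCoord_mem_unitary)

theorem coordIsometry_pow_apply (n : ℕ) (x : K) :
    (coordIsometry M ^ n) x = M (circleCoord ^ n) x := by
  induction n generalizing x with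
  | zero => rw [pow_zero, pow_zero, map_one]; rfl
  | succ n ih =>
    rw [pow_succ, pow_succ, map_mul]
    exact ih _

theorem map_star_circleCoord_coordIsometry (x : K) :
    M (star circleCoord) (coordIsometry M x) = x := by
  change (M (star circleCoord) * M circleCoord) x = x
  rw [← map_mul, star_circleCoord_mul_self, map_one, one_apply_eq_self]

theorem map_star_circleCoord_pow_coordIsometry_pow (n : ℕ) (x : K) :
    M (star circleCoord ^ n) ((coordIsometry M ^ n) x) = x := by
  rw [coordIsometry_pow_apply, ← mul_apply_eq_comp, ← map_mul, ← mul_pow,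
    star_circleCoord_mul_self, one_pow, map_one, one_apply_eq_self]

theorem coordIsometry_pow_map_star_circleCoord_pow (n : ℕ) (x : K) :
    (coordIsometry M ^ n) (M (star circleCoord ^ n) x) = x := by
  rw [coordIsometry_pow_apply, ← mul_apply_eq_comp, ← map_mul, ← mul_pow, mul_comm circleCoord,
    star_circleCoord_mul_self, one_pow, map_one, one_apply_eq_self]

end CoordIsometry

variable {M : C(Circle, ℂ) →⋆ₐ[ℂ] (K →L[ℂ] K)}

open scoped CStarAlgebra in
theorem map_mem_of_reduces_circleCoord {R : Submodule ℂ K} (hR : IsClosed (R : Set K))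
    (h : ∀ x ∈ R, coordIsometry M x ∈ R) (hstar : ∀ x ∈ R, M (star circleCoord) x ∈ R)
    (c : C(Circle, ℂ)) : ∀ x ∈ R, M c x ∈ R := by
  induction c using induction_circleCoord with
  | const c =>
    intro x hx
    change M (algebraMap ℂ C(Circle, ℂ) c) x ∈ R
    rw [AlgHomClass.commutes]
    exact R.smul_mem c hx
  | coord => exact h
  | star_coord => exact hstar
  | add f g hf hg =>
    intro x hx
    rw [map_add]
    exact R.add_mem (hf x hx) (hg x hx)
  | mul f g hf hg =>
    intro x hx
    rw [map_mul]
    exact hf _ (hg x hx)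
  | closed =>
    simp only [Set.ofPred_forall]
    exact isClosed_iInter fun x => isClosed_iInter fun _ =>
      hR.preimage ((map_continuous M).clm_apply continuous_const)

theorem IsPure.eq_bot_of_le_range {H : Type*} [NormedAddCommGroup H] [InnerProductSpace ℂ H]
    {ν : neilAlgebra →ₙₐ[ℂ] (H →L[ℂ] H)} (hν : IsPure ν) {T : H →ₗᵢ[ℂ] K}
    (hT : ∀ a h, T (ν a h) = boundaryRep M a (T h)) {R : Submodule ℂ K}
    (hR : ∀ c, ∀ x ∈ R, M c x ∈ R) (hRT : R ≤ T.toLinearMap.range) : R = ⊥ := by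
  refine (Submodule.eq_bot_iff R).2 fun x hx => ?_
  obtain ⟨h, rfl⟩ := hRT hx
  suffices h ∈ ({0} : Set H) by rw [Set.mem_singleton_iff.1 this]; exact T.map_zero
  rw [← hν]
  refine Set.mem_iInter₂.2 fun a ha => ?_
  have ha' (z : Circle) : boundaryValues a z ≠ 0 := by
    rw [boundaryValues_apply]
    exact ha z (Circle.norm_coe z)
  let b : C(Circle, ℂ) := ⟨fun z => (boundaryValues a z)⁻¹, (boundaryValues a).continuous.inv₀ ha'⟩
  have hab : boundaryValues a * b = 1 := ContinuousMap.ext fun z => mul_inv_cancel₀ (ha' z)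
  obtain ⟨h', hh'⟩ := hRT (hR b _ hx)
  refine ⟨h', T.injective ?_⟩
  calc T (ν a h') = M (boundaryValues a) (M b (T h)) := (hT a h').trans (congrArg _ hh')
    _ = M (boundaryValues a * b) (T h) := by rw [map_mul]; rfl
    _ = T h := by rw [hab, map_one]; rfl

end CircleRepresentation

/-! ### The model of a pure representation -/

theorem unitarilyEquivalent_of_neilMonomial {H H' : Type*} [NormedAddCommGroup H]
    [InnerProductSpace ℂ H] [NormedAddCommGroup H'] [InnerProductSpace ℂ H']
    {ρ : neilAlgebra →ₙₐ[ℂ] (H →L[ℂ] H)} {σ : neilAlgebra →ₙₐ[ℂ] (H' →L[ℂ] H')}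
    (hρ : IsCompletelyContractive ρ) (hσ : IsCompletelyContractive σ) (U : H ≃ₗᵢ[ℂ] H')
    (hU : ∀ (n : ℕ) (hn : n ≠ 1) h, U (ρ (neilMonomial hn) h) = σ (neilMonomial hn) (U h)) :
    UnitarilyEquivalent ρ σ := by
  suffices ∀ h, U.toLinearEquiv.toLinearMap ∘ₗ ContinuousLinearMap.apply ℂ H h ∘ₗ
        (ρ : neilAlgebra →ₗ[ℂ] H →L[ℂ] H) =
      ContinuousLinearMap.apply ℂ H' (U h) ∘ₗ (σ : neilAlgebra →ₗ[ℂ] H' →L[ℂ] H') from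
    ⟨U, fun a h => LinearMap.congr_fun (this h) a⟩
  exact fun h => eq_of_eq_neilMonomial (U.continuous.comp (hρ.continuous_apply h))
    (hσ.continuous_apply (U h)) fun n hn => hU n hn h

section LinearPart

variable {N : Type*} [NormedAddCommGroup N] [InnerProductSpace ℂ N] [CompleteSpace N]

theorem mem_linearPart_of_taylorCoeff_eq_zero {f : Hardy N}
    (hf : ∀ n, taylorCoeff f (n + 2) = 0) : f ∈ linearPart N := by
  refine ⟨taylorCoeff f 0, taylorCoeff f 1, fun z hz => ?_⟩
  have hsum : HasSum (fun n => z ^ n • taylorCoeff f n)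
      (∑ n ∈ Finset.range 2, z ^ n • taylorCoeff f n) :=
    hasSum_sum_of_ne_finset_zero fun n hn => by
      obtain ⟨m, rfl⟩ := Nat.exists_eq_add_of_le' (not_lt.1 fun h => hn (Finset.mem_range.2 h))
      rw [hf, smul_zero]
  rw [(hasSum_taylorCoeff f.differentiableOn hz).unique hsum]
  simp only [Finset.sum_range_succ, Finset.sum_range_zero, zero_add, pow_zero, one_smul, pow_one]

theorem mem_linearPart_of_inner_eq_zero {f : Hardy N}
    (hf : ∀ g : Hardy N, ⟪mulOp (monomial_mem_discAlgebra 2) g, f⟫_ℂ = 0) : f ∈ linearPart N := by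
  refine mem_linearPart_of_taylorCoeff_eq_zero fun n => ?_
  let g : Hardy N := Hardy.coeffEquiv.symm (lp.single 2 n (taylorCoeff f (n + 2)))
  have hg (m : ℕ) : taylorCoeff g m = (Pi.single n (taylorCoeff f (n + 2)) : ℕ → N) m := by
    rw [← Hardy.coeffEquiv_apply, LinearEquiv.apply_symm_apply]
    rfl
  have hfg := hf g
  rw [Hardy.inner_eq_tsum, tsum_eq_single (n + 2), taylorCoeff_mulOp_monomial_add, hg,
    Pi.single_eq_same, inner_self_eq_zero] at hfg
  · exact hfg
  · intro m hm
    rcases lt_or_ge m 2 with h2 | h2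
    · rw [taylorCoeff_mulOp_monomial_of_lt h2, inner_zero_left]
    · obtain ⟨m, rfl⟩ := Nat.exists_eq_add_of_le' h2
      rw [taylorCoeff_mulOp_monomial_add, hg, Pi.single_eq_of_ne (by omega), inner_zero_left]

variable {H : Type*} [NormedAddCommGroup H] [InnerProductSpace ℂ H] [CompleteSpace H]

theorem exists_unitarilyEquivalent_mulRep {ν : neilAlgebra →ₙₐ[ℂ] (H →L[ℂ] H)}
    (hν : IsCompletelyContractive ν) (S : H →ₗᵢ[ℂ] Hardy N)
    (hS : ∀ (n : ℕ) (hn : n ≠ 1) h,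
      S (ν (neilMonomial hn) h) = mulOp (monomial_mem_discAlgebra n) (S h))
    (hSr : ∀ f, mulOp (monomial_mem_discAlgebra 2) f ∈ S.toLinearMap.range) :
    ∃ (V : Submodule ℂ (Hardy N)) (hV : V ≤ linearPart N),
      IsClosed (V : Set (Hardy N)) ∧ UnitarilyEquivalent ν (mulRep V hV) := by
  have hrange : CompleteSpace S.toLinearMap.range :=
    S.isometry.isUniformInducing.isComplete_range.completeSpace_coe
  have hV : S.toLinearMap.rangeᗮ ≤ linearPart N := fun f hf =>
    mem_linearPart_of_inner_eq_zero fun g => hf _ (hSr g)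
  let U : H ≃ₗᵢ[ℂ] S.toLinearMap.rangeᗮᗮ :=
    S.equivRange.trans (.ofEq _ _ (Submodule.orthogonal_orthogonal _).symm)
  exact ⟨_, hV, Submodule.isClosed_orthogonal _, unitarilyEquivalent_of_neilMonomial hν
    (isCompletelyContractive_mulRep hV) U fun n hn h => Subtype.ext (hS n hn h)⟩

theorem exists_unitarilyEquivalent_mulRep_of_isometry {ν : neilAlgebra →ₙₐ[ℂ] (H →L[ℂ] H)}
    (hν : IsCompletelyContractive ν) {K : Type*} [NormedAddCommGroup K] [InnerProductSpace ℂ K]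
    [CompleteSpace K] {U : K →ₗᵢ[ℂ] K} (hU : ⨅ n : ℕ, (U ^ n).toLinearMap.range = ⊥)
    (T : H →ₗᵢ[ℂ] K)
    (hT : ∀ (n : ℕ) (hn : n ≠ 1) h, T (ν (neilMonomial hn) h) = (U ^ n) (T h))
    (hTr : ∀ x, (U ^ 2) x ∈ T.toLinearMap.range) :
    ∃ (V : Submodule ℂ (Hardy (wandering U))) (hV : V ≤ linearPart (wandering U)),
      IsClosed (V : Set (Hardy (wandering U))) ∧ UnitarilyEquivalent ν (mulRep V hV) := by
  have hJ (h : H) : woldEquiv hU ((woldEquiv hU).symm (T h)) = T h :=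
    (woldEquiv hU).apply_symm_apply _
  refine exists_unitarilyEquivalent_mulRep hν ((woldEquiv hU).symm.toLinearIsometry.comp T)
    (fun n hn h => (woldEquiv hU).injective ?_) fun f => ?_
  · exact ((hJ _).trans (hT n hn h)).trans
      ((congrArg _ (hJ h).symm).trans (woldEquiv_mulOp_monomial hU n _).symm)
  · obtain ⟨h, hh⟩ := hTr (woldEquiv hU f)
    exact ⟨h, (woldEquiv hU).injective
      (((hJ h).trans hh).trans (woldEquiv_mulOp_monomial hU 2 f).symm)⟩

end LinearPart

section Restriction

variable {K : Type*} [NormedAddCommGroup K] [InnerProductSpace ℂ K] {U : K →ₗᵢ[ℂ] K}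
  {L : Submodule ℂ K} (hL : ∀ x ∈ L, U x ∈ L)

/-- The restriction of an isometry to an invariant subspace. -/
def restrictIsometry : L →ₗᵢ[ℂ] L where
  toLinearMap := U.toLinearMap.restrict hL
  norm_map' x := U.norm_map x

theorem coe_restrictIsometry_pow_apply (n : ℕ) (x : L) :
    ((restrictIsometry hL ^ n) x : K) = (U ^ n) x := by
  induction n generalizing x with
  | zero => rfl
  | succ n ih =>
    rw [pow_succ, pow_succ]
    exact ih _

end Restriction

section ShiftInvariant

variable {K : Type*} [NormedAddCommGroup K] [InnerProductSpace ℂ K]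

/-- The subspace of all `x` with `U² x ∈ X` and `U³ x ∈ X`. If `X` is invariant under `U²` and `U³`
it contains `X` and is invariant under `U`. -/
def shiftSaturation (U : K →ₗᵢ[ℂ] K) (X : Submodule ℂ K) : Submodule ℂ K :=
  X.comap (U ^ 2).toLinearMap ⊓ X.comap (U ^ 3).toLinearMap

variable {U : K →ₗᵢ[ℂ] K} {X : Submodule ℂ K}

theorem isClosed_shiftSaturation (hX : IsClosed (X : Set K)) :
    IsClosed (shiftSaturation U X : Set K) :=
  (hX.preimage (U ^ 2).continuous).inter (hX.preimage (U ^ 3).continuous)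

theorem map_mem_shiftSaturation (h2 : ∀ x ∈ X, (U ^ 2) x ∈ X) :
    ∀ x ∈ shiftSaturation U X, U x ∈ shiftSaturation U X :=
  fun _ hx => ⟨hx.2, h2 _ hx.1⟩

/-- The largest subspace of `L` that is invariant under the adjoint of the coordinate function. -/
def reducingPart [CompleteSpace K] (M : C(Circle, ℂ) →⋆ₐ[ℂ] (K →L[ℂ] K)) (L : Submodule ℂ K) :
    Submodule ℂ K :=
  ⨅ n : ℕ, L.comap (M (star circleCoord ^ n) : K →ₗ[ℂ] K)

variable [CompleteSpace K] {M : C(Circle, ℂ) →⋆ₐ[ℂ] (K →L[ℂ] K)} {L : Submodule ℂ K}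

theorem mem_reducingPart {x : K} :
    x ∈ reducingPart M L ↔ ∀ n : ℕ, M (star circleCoord ^ n) x ∈ L := Submodule.mem_iInf _

theorem map_mem_reducingPart (hLc : IsClosed (L : Set K)) (hL : ∀ x ∈ L, coordIsometry M x ∈ L)
    (c : C(Circle, ℂ)) : ∀ x ∈ reducingPart M L, M c x ∈ reducingPart M L := by
  refine map_mem_of_reduces_circleCoord ?_ (fun x hx => ?_) (fun x hx => ?_) c
  · rw [reducingPart, Submodule.coe_iInf]
    exact isClosed_iInter fun n => hLc.preimage (M (star circleCoord ^ n)).continuous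
  · rw [mem_reducingPart] at hx ⊢
    rintro (_ | n)
    · simpa using hL x (by simpa using hx 0)
    · rw [pow_succ, map_mul, mul_apply_eq_comp, map_star_circleCoord_coordIsometry]
      exact hx n
  · rw [mem_reducingPart] at hx ⊢
    intro n
    rw [← mul_apply_eq_comp, ← map_mul, ← pow_succ]
    exact hx (n + 1)

theorem reducingPart_shiftSaturation_le :
    reducingPart M (shiftSaturation (coordIsometry M) X) ≤ X := fun x hx => by
  rw [← coordIsometry_pow_map_star_circleCoord_pow M 2 x]
  exact (mem_reducingPart.1 hx 2).1

theorem iInf_range_restrictIsometry_pow (hL : ∀ x ∈ L, coordIsometry M x ∈ L)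
    (hR : reducingPart M L = ⊥) : ⨅ n : ℕ, (restrictIsometry hL ^ n).toLinearMap.range = ⊥ := by
  refine (Submodule.eq_bot_iff _).2 fun x hx => Subtype.ext ?_
  rw [ZeroMemClass.coe_zero, ← Submodule.mem_bot ℂ, ← hR, mem_reducingPart]
  intro n
  obtain ⟨y, rfl⟩ := (Submodule.mem_iInf _).1 hx n
  change M (star circleCoord ^ n) ((restrictIsometry hL ^ n) y : L) ∈ L
  rw [coe_restrictIsometry_pow_apply, map_star_circleCoord_pow_coordIsometry_pow]
  exact y.2

end ShiftInvariant

theorem IsPure.exists_unitarilyEquivalent {H : Type w} [NormedAddCommGroup H]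
    [InnerProductSpace ℂ H] [CompleteSpace H] {ν : neilAlgebra →ₙₐ[ℂ] (H →L[ℂ] H)} (hν : IsPure ν)
    (hcc : IsCompletelyContractive ν) {K : Type w} [NormedAddCommGroup K] [InnerProductSpace ℂ K]
    [CompleteSpace K] {M : C(Circle, ℂ) →⋆ₐ[ℂ] (K →L[ℂ] K)} (T : H →ₗᵢ[ℂ] K)
    (hT : ∀ a h, T (ν a h) = boundaryRep M a (T h)) :
    ∃ (N : Type w) (_ : NormedAddCommGroup N) (_ : InnerProductSpace ℂ N) (_ : CompleteSpace N)
      (V : Submodule ℂ (Hardy N)) (hV : V ≤ linearPart N),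
      IsClosed (V : Set (Hardy N)) ∧ UnitarilyEquivalent ν (mulRep V hV) := by
  have hTn {n : ℕ} (hn : n ≠ 1) (h : H) :
      T (ν (neilMonomial hn) h) = (coordIsometry M ^ n) (T h) := by
    rw [hT, boundaryRep_apply, boundaryValues_neilMonomial, coordIsometry_pow_apply]
  let X := T.toLinearMap.range
  have hX {n : ℕ} (hn : n ≠ 1) : ∀ x ∈ X, (coordIsometry M ^ n) x ∈ X := by
    rintro _ ⟨h, rfl⟩
    exact ⟨_, hTn hn h⟩
  let L := shiftSaturation (coordIsometry M) X
  have hL : ∀ x ∈ L, coordIsometry M x ∈ L := map_mem_shiftSaturation (hX (n := 2) (by decide))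
  have hLc : IsClosed (L : Set K) :=
    isClosed_shiftSaturation T.isometry.isClosedEmbedding.isClosed_range
  have : CompleteSpace L := hLc.completeSpace_coe
  have hR : reducingPart M L = ⊥ :=
    hν.eq_bot_of_le_range hT (map_mem_reducingPart hLc hL) reducingPart_shiftSaturation_le
  have hTL (h : H) : T h ∈ L := ⟨hX (by decide) _ ⟨h, rfl⟩, hX (by decide) _ ⟨h, rfl⟩⟩
  refine ⟨wandering (restrictIsometry hL), inferInstance, inferInstance, inferInstance,
    exists_unitarilyEquivalent_mulRep_of_isometry hcc (iInf_range_restrictIsometry_pow hL hR)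
      ⟨T.toLinearMap.codRestrict L hTL, T.norm_map⟩ (fun n hn h => Subtype.ext ?_) fun x => ?_⟩
  · rw [coe_restrictIsometry_pow_apply]
    exact hTn hn h
  · obtain ⟨h, hh⟩ := x.2.1
    exact ⟨h, Subtype.ext (hh.trans (coe_restrictIsometry_pow_apply hL 2 x).symm)⟩

end NeilRep

end

theorem theorem4p1 :
    (∀ (N : Type u) [NormedAddCommGroup N] [InnerProductSpace ℂ N] [CompleteSpace N]
      (V : Submodule ℂ (NeilRep.Hardy N)) (hV : V ≤ NeilRep.linearPart N),
      NeilRep.IsUnital (NeilRep.mulRep V hV) ∧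
      NeilRep.IsPure (NeilRep.mulRep V hV) ∧
      NeilRep.IsCompletelyContractive (NeilRep.mulRep V hV) ∧
      NeilRep.IsExtremal.{v} (NeilRep.mulRep V hV)) ∧
    (∀ (H : Type w) [NormedAddCommGroup H] [InnerProductSpace ℂ H] [CompleteSpace H]
      (ν : NeilRep.neilAlgebra →ₙₐ[ℂ] (H →L[ℂ] H)),
      NeilRep.IsUnital ν → NeilRep.IsPure ν → NeilRep.IsCompletelyContractive ν →
      NeilRep.IsExtremal.{w} ν →
      ∃ (N : Type w) (_ : NormedAddCommGroup N) (_ : InnerProductSpace ℂ N) (_ : CompleteSpace N)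
        (V : Submodule ℂ (NeilRep.Hardy N)) (hV : V ≤ NeilRep.linearPart N),
        IsClosed (V : Set (NeilRep.Hardy N)) ∧
        NeilRep.UnitarilyEquivalent ν (NeilRep.mulRep V hV)) := by
  refine ⟨fun N _ _ _ V hV => ⟨NeilRep.isUnital_mulRep hV, NeilRep.isPure_mulRep hV,
    NeilRep.isCompletelyContractive_mulRep hV, NeilRep.isExtremal_mulRep hV⟩,
    fun H _ _ _ ν h1 hpure hcc hext => ?_⟩
  obtain ⟨K, _, _, _, M, T, hM, hT⟩ := hcc.exists_dilation h1
  exact hpure.exists_unitarilyEquivalent hcc T fun a h =>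
    DFunLike.congr_fun (hext K (NeilRep.boundaryRep M) hM T hT a) h
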